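/- Let $\mathcal A=\{a,b,c\}$ be an alphabet of three distinct letters and let $\mathcal H$ be the involutory antimorphism of $\mathcal A^*$ that reverses a word and exchanges the letters $b$ and $c$, i.e. $\mathcal H=R\circ\tau$ with $R$ the reversal and $\tau(a)=a$, $\tau(b)=c$, $\tau(c)=b$. For an involutory antimorphism $\mathcal V$ and a finite word $u=sq$, with $q$ the longest suffix of $u$ satisfying $\mathcal V(q)=q$, put $u^{\oplus}=sq\mathcal V(s)$; put $\mathrm{Pal}_{\mathcal V}(\varepsilon)=\varepsilon$ and $\mathrm{Pal}_{\mathcal V}(wx)=(\mathrm{Pal}_{\mathcal V}(w)x)^{\oplus}$ for words $w$ and letters $x$; and for an infinite word $\mathbf w=w_1w_2\cdots$ put $\mathrm{IPal}_{\mathcal V}(\mathbf w)=\lim_{k\to\infty}\mathrm{Pal}_{\mathcal V}(w_1\cdots w_k)$. An infinite word is pseudostandard if it equals $\mathrm{IPal}_{\mathcal V}(\mathbf w)$ for some infinite word $\mathbf w$ and some involutory antimorphism $\mathcal V$; it is standard episturmian if it equals $\mathrm{IPal}_R(\mathbf w)$ for some $\mathbf w$, and episturmian if it has the same finite factors as some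 standard episturmian word. Let $n\ge 1$ and let $\mathbf s=\mathbf s_{\mathcal H,n,a,b,c}$ be the fixed point of $\mathrm{IPal}_{\mathcal H}$ that begins with $a^nb$, i.e. $\mathrm{IPal}_{\mathcal H}(\mathbf s)=\mathbf s$ and $a^nb$ is a prefix of $\mathbf s$. Then: 1. $\mathbf s$ is not episturmian, but it is pseudostandard. 2. $\mathbf s$ is not a fixed point of any morphism $\mathcal A^*\to\mathcal A^*$ other than the identity. 3. $\mathbf s$ has no factor of the form $u^{n+4}$ with $u$ a nonempty word, but it has a factor of the form $u^{n+3}$ with $u$ a nonempty word. 4. The letters $b$ and $c$ have frequencies in $\mathbf s$ (limits, as $k\to\infty$, of the proportion of the letter in the prefix of length $k$), and these frequencies are equal. -/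

import Mathlib

open Filter Topology

/-! Finite words over `A` are lists; infinite words are functions `ℕ → A` (indexed from `0`). -/

section Words

variable {A : Type*}

/-- The factor of length `k` of the infinite word `s` that starts at position `i`. -/
def factorAt (s : ℕ → A) (i k : ℕ) : List A := (List.range k).map (fun j => s (i + j))

/-- The prefix of length `k` of the infinite word `s`. -/
def prefixOf (s : ℕ → A) (k : ℕ) : List A := factorAt s 0 k

/-- The finite word `v` is a factor of the infinite word `s`. -/
def IsFactorOf (v : List A) (s : ℕ → A) : Prop := ∃ i, factorAt s i v.length = v

/-- The finite word `v` is a prefix of the infinite word `s`. -/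
def IsPrefixOf (v : List A) (s : ℕ → A) : Prop := prefixOf s v.length = v

/-- The antimorphism `R ∘ τ`: apply the letter permutation `τ` and reverse. It is involutory
exactly when `τ` is. -/
def antimorphism (τ : Equiv.Perm A) (u : List A) : List A := (u.map τ).reverse

/-- `u` is a pseudopalindrome for the antimorphism given by `τ`. -/
def IsPseudopalindrome (τ : Equiv.Perm A) (u : List A) : Prop := antimorphism τ u = u

instance [DecidableEq A] (τ : Equiv.Perm A) (u : List A) : Decidable (IsPseudopalindrome τ u) :=
  inferInstanceAs (Decidable (antimorphism τ u = u))

theorem exists_pseudopalindromic_suffix (τ : Equiv.Perm A) (u : List A) :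
    ∃ k, IsPseudopalindrome τ (u.drop k) :=
  ⟨u.length, by simp [IsPseudopalindrome, antimorphism]⟩

/-- The pseudopalindromic closure `s q V(s)` of `u = s q`, where `q` is the longest
pseudopalindromic suffix of `u`, that is, `s` is as short as possible. -/
def pseudoClosure [DecidableEq A] (τ : Equiv.Perm A) (u : List A) : List A :=
  let k := Nat.find (exists_pseudopalindromic_suffix τ u)
  u.take k ++ u.drop k ++ antimorphism τ (u.take k)

/-- The iterated pseudopalindromic closure of a finite word:
`Pal(ε) = ε` and `Pal(w x) = (Pal(w) x)^⊕`. -/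
def pseudoPal [DecidableEq A] (τ : Equiv.Perm A) (w : List A) : List A :=
  w.foldl (fun p x => pseudoClosure τ (p ++ [x])) []

theorem prefixOf_succ (s : ℕ → A) (k : ℕ) : prefixOf s (k + 1) = prefixOf s k ++ [s k] := by
  simp [prefixOf, factorAt, List.range_succ]

theorem pseudoPal_append_singleton [DecidableEq A] (τ : Equiv.Perm A) (w : List A) (x : A) :
    pseudoPal τ (w ++ [x]) = pseudoClosure τ (pseudoPal τ w ++ [x]) := by
  simp [pseudoPal, List.foldl_append]

theorem prefix_pseudoClosure [DecidableEq A] (τ : Equiv.Perm A) (u : List A) :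
    u <+: pseudoClosure τ u := by
  simp [pseudoClosure, List.take_append_drop]

theorem lt_length_pseudoPal [DecidableEq A] (τ : Equiv.Perm A) (w : ℕ → A) (m : ℕ) :
    m < (pseudoPal τ (prefixOf w (m + 1))).length := by
  induction m with
  | zero =>
    rw [prefixOf_succ, pseudoPal_append_singleton]
    have h := (prefix_pseudoClosure τ (pseudoPal τ (prefixOf w 0) ++ [w 0])).length_le
    simp only [List.length_append, List.length_singleton] at h
    omega
  | succ m ih =>
    rw [prefixOf_succ, pseudoPal_append_singleton]
    have h := (prefix_pseudoClosure τ
      (pseudoPal τ (prefixOf w (m + 1)) ++ [w (m + 1)])).length_le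
    simp only [List.length_append, List.length_singleton] at h
    omega

/-- The operator `IPal`: the infinite word `lim Pal(w[0] ⋯ w[k-1])`, letter by letter. -/
def pseudoIPal [DecidableEq A] (τ : Equiv.Perm A) (w : ℕ → A) : ℕ → A := fun m =>
  (pseudoPal τ (prefixOf w (m + 1)))[m]'(lt_length_pseudoPal τ w m)

theorem pseudoPal_prefix_of_le [DecidableEq A] (τ : Equiv.Perm A) (w : ℕ → A) {k l : ℕ}
    (h : k ≤ l) : pseudoPal τ (prefixOf w k) <+: pseudoPal τ (prefixOf w l) := by
  induction l, h using Nat.le_induction with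
  | base => exact List.prefix_rfl
  | succ l _ ih =>
    rw [prefixOf_succ, pseudoPal_append_singleton]
    exact ih.trans ((List.prefix_append _ _).trans (prefix_pseudoClosure τ _))

/-- `pseudoIPal τ w` is indeed the limit: all the words `Pal(w[0] ⋯ w[k-1])` are prefixes of it. -/
theorem isPrefixOf_pseudoIPal [DecidableEq A] (τ : Equiv.Perm A) (w : ℕ → A) (k : ℕ) :
    IsPrefixOf (pseudoPal τ (prefixOf w k)) (pseudoIPal τ w) := by
  unfold IsPrefixOf
  apply List.ext_getElem
  · simp [prefixOf, factorAt]
  · intro m h1 h2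
    have h3 : ∀ (t : ℕ → A) (l : ℕ) (h : m < (prefixOf t l).length), (prefixOf t l)[m] = t m := by
      intro t l h
      simp [prefixOf, factorAt]
    rw [h3]
    rcases le_total k (m + 1) with h | h
    · exact ((pseudoPal_prefix_of_le τ w h).getElem h2).symm
    · exact (pseudoPal_prefix_of_le τ w h).getElem (lt_length_pseudoPal τ w m)

/-- A pseudostandard word: one obtained by the operator `IPal` of an involutory antimorphism. -/
def IsPseudostandard [DecidableEq A] (s : ℕ → A) : Prop :=
  ∃ τ : Equiv.Perm A, Function.Involutive τ ∧ ∃ Δ : ℕ → A, s = pseudoIPal τ Δ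

/-- A standard episturmian word: one obtained by the iterated palindromic closure, that is,
with the reversal (`τ = 1`) as antimorphism. -/
def IsStandardEpisturmian [DecidableEq A] (s : ℕ → A) : Prop :=
  ∃ Δ : ℕ → A, s = pseudoIPal 1 Δ

/-- An episturmian word: one with the same factors as some standard episturmian word. -/
def IsEpisturmian [DecidableEq A] (s : ℕ → A) : Prop :=
  ∃ t : ℕ → A, IsStandardEpisturmian t ∧ ∀ v : List A, IsFactorOf v s ↔ IsFactorOf v t

/-- The image under the morphism `φ` of the prefix of length `k` of `s`. -/
def imagePrefix (φ : FreeMonoid A →* FreeMonoid A) (s : ℕ → A) (k : ℕ) : List A :=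
  (φ (FreeMonoid.ofList (prefixOf s k))).toList

/-- `φ(s) = s`: the images of the prefixes of `s` are prefixes of `s` and their lengths are
unbounded (so that `φ(s)` is infinite; `φ` may erase letters). -/
def IsFixedByMorphism (φ : FreeMonoid A →* FreeMonoid A) (s : ℕ → A) : Prop :=
  (∀ k, IsPrefixOf (imagePrefix φ s k) s) ∧ ∀ m, ∃ k, m ≤ (imagePrefix φ s k).length

/-- `s` contains an `m`-th power of a nonempty word. -/
def ContainsPower (s : ℕ → A) (m : ℕ) : Prop :=
  ∃ u : List A, u ≠ [] ∧ IsFactorOf (List.replicate m u).flatten s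

/-- The letter `x` has frequency `ρ` in `s`. -/
def HasFrequency [DecidableEq A] (s : ℕ → A) (x : A) (ρ : ℝ) : Prop :=
  Tendsto (fun k : ℕ => ((prefixOf s k).count x : ℝ) / (k : ℝ)) atTop (𝓝 ρ)

end Words

/-! ### Infinite words, images under substitutions, and unique desubstitution -/

section InfiniteWords

variable {A : Type*}

/-! Let ψ_x fix `x` and send every other letter `u` to `xu`, and let mu send `u` to `u τ(u)`, or to
`u` if τ fixes it. Justin's formula for iterated palindromic closure extends to Pal_τ = mu ∘ Pal_R
(`pseudoPal_eq_epal`). As `s` is its own directive word, it is for every `j` the image under mu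
ψ_{s_0} ⋯ ψ_{s_{j-1}} of the standard episturmian word `level s j` directed by s_j s_{j+1} ⋯. The
proof moves up and down this tower. Desubstitution is unique because one letter marks the starts of
the blocks (`IsSeparating`); mu ψ_a has this property too, its blocks being a, abc, acb.

Not episturmian: in a standard episturmian word one of any two neighbouring letters is the first
directive letter, but ab, bc and ca are all factors of `s`.

Powers: a long run of period `p` desubstitutes to a run of smaller period one level up. Weighting
letters by the lengths of their images in `s`, each step loses at most the weight of one separating
letter. The process ends at a run shorter than two periods or at a run of one letter, and the latter
comes from a run of that letter in the directive word, which is `s` again; the prefix a^n b bounds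
such runs. This gives `weight_run_lt`. Conversely, a run a^{n+1} inside `s`, read as directive
letters, produces a^{n+2} in a level, and the image of that extends to an (n+3)-rd power
(`containsPower`).

Morphisms: if `F` fixes `s`, then F ∘ σ_p = σ_q ∘ χ for some `χ` from level `p` to level `q`, where
σ_j maps level `j` to `s`. Raising `p` and removing common prefixes by raising `q` simplifies `χ`
until it is a permutation of letters. It carries the directive word from `p` on to the one from `q`
on, so p ≠ q would make `s` eventually periodic, contrary to the power bound. Hence p = q, `χ` is
the identity, and cancelling down the tower `F` is the identity.

Frequencies: the lengths of blocks and their counts of `b` satisfy the same positive recursion. As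
all letters recur with bounded gaps, the ratios contract to one limit, and every block contains `b`
and `c` equally often. -/

@[simp] theorem length_factorAt (s : ℕ → A) (i k : ℕ) : (factorAt s i k).length = k := by
  simp [factorAt]

@[simp] theorem length_prefixOf (s : ℕ → A) (k : ℕ) : (prefixOf s k).length = k := by
  simp [prefixOf]

@[simp] theorem getElem_factorAt (s : ℕ → A) (i k j : ℕ) (h : j < (factorAt s i k).length) :
    (factorAt s i k)[j] = s (i + j) := by
  simp [factorAt]

@[simp] theorem getElem_prefixOf (s : ℕ → A) (k j : ℕ) (h : j < (prefixOf s k).length) :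
    (prefixOf s k)[j] = s j := by
  simp [prefixOf]

theorem factorAt_eq_iff {s : ℕ → A} {i : ℕ} {v : List A} :
    factorAt s i v.length = v ↔ ∀ j (h : j < v.length), v[j] = s (i + j) := by
  constructor
  · intro h j hj
    have := List.getElem_of_eq h.symm hj
    simpa using this
  · intro h
    apply List.ext_getElem
    · simp
    · intro j h1 h2
      simp [h j h2]

theorem isPrefixOf_iff {v : List A} {s : ℕ → A} :
    IsPrefixOf v s ↔ ∀ j (h : j < v.length), v[j] = s j := by
  have := factorAt_eq_iff (s := s) (i := 0) (v := v)
  simpa [IsPrefixOf, prefixOf] using this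

theorem isPrefixOf_prefixOf (s : ℕ → A) (k : ℕ) : IsPrefixOf (prefixOf s k) s := by
  simp [IsPrefixOf]

theorem factorAt_add (s : ℕ → A) (i k l : ℕ) :
    factorAt s i (k + l) = factorAt s i k ++ factorAt s (i + k) l := by
  simp [factorAt, List.range_add, Function.comp_def, Nat.add_assoc]

theorem prefixOf_add (s : ℕ → A) (k l : ℕ) :
    prefixOf s (k + l) = prefixOf s k ++ factorAt s k l := by
  simp [prefixOf, factorAt_add]

theorem mem_factorAt {s : ℕ → A} {i k : ℕ} {x : A} :
    x ∈ factorAt s i k ↔ ∃ j < k, s (i + j) = x := by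
  simp [factorAt]

theorem mem_prefixOf {s : ℕ → A} {k : ℕ} {x : A} :
    x ∈ prefixOf s k ↔ ∃ j < k, s j = x := by
  simp [prefixOf, mem_factorAt]

theorem prefixOf_prefix (s : ℕ → A) {k l : ℕ} (h : k ≤ l) : prefixOf s k <+: prefixOf s l := by
  obtain ⟨m, rfl⟩ := Nat.exists_eq_add_of_le h
  rw [prefixOf_add]
  exact List.prefix_append _ _

theorem IsPrefixOf.of_prefix {u v : List A} {s : ℕ → A} (hv : IsPrefixOf v s) (h : u <+: v) :
    IsPrefixOf u s := by
  rw [isPrefixOf_iff] at *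
  intro j hj
  rw [h.getElem hj]
  exact hv j _

theorem IsPrefixOf.prefix_of_le {u v : List A} {s : ℕ → A} (hu : IsPrefixOf u s)
    (hv : IsPrefixOf v s) (h : u.length ≤ v.length) : u <+: v := by
  rw [← hu, ← hv]
  exact prefixOf_prefix s h

theorem flatMap_prefix {B : Type*} {u v : List A} (h : u <+: v) (σ : A → List B) :
    u.flatMap σ <+: v.flatMap σ := by
  obtain ⟨r, rfl⟩ := h
  simp

theorem IsPrefixOf.append_iff {u v : List A} {s : ℕ → A} :
    IsPrefixOf (u ++ v) s ↔ IsPrefixOf u s ∧ factorAt s u.length v.length = v := by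
  unfold IsPrefixOf
  rw [List.length_append, prefixOf_add]
  constructor
  · intro h
    exact List.append_inj h (by simp)
  · rintro ⟨h1, h2⟩
    rw [h1, h2]

theorem flatMap_length_ge {σ : A → List A} (hσ : ∀ u, σ u ≠ []) (l : List A) :
    l.length ≤ (l.flatMap σ).length := by
  induction l with
  | nil => simp
  | cons u l ih =>
    have := List.length_pos_iff.2 (hσ u)
    simp only [List.flatMap_cons, List.length_append, List.length_cons]
    omega

theorem flatMap_replicate (σ : A → List A) (m : ℕ) (u : A) :
    (List.replicate m u).flatMap σ = (List.replicate m (σ u)).flatten := by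
  induction m with
  | zero => simp
  | succ m ih => simp [List.replicate_succ, ih]

theorem factorAt_of_prefix {w : ℕ → A} {i : ℕ} {u v : List A} (hv : factorAt w i v.length = v)
    (h : u <+: v) : factorAt w i u.length = u := by
  rw [factorAt_eq_iff] at *
  intro j hj
  rw [h.getElem hj]
  exact hv j _

/-- The infinite word `w` is the image of `w'` under the substitution `σ`. -/
def Maps (σ : A → List A) (w' w : ℕ → A) : Prop :=
  ∀ k, IsPrefixOf ((prefixOf w' k).flatMap σ) w

/-- The position in the image of `w'` at which the image of the letter number `k` starts. -/
def blockPos (σ : A → List A) (w' : ℕ → A) (k : ℕ) : ℕ := ((prefixOf w' k).flatMap σ).length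

@[simp] theorem blockPos_zero (σ : A → List A) (w' : ℕ → A) : blockPos σ w' 0 = 0 := by
  simp [blockPos, prefixOf, factorAt]

theorem blockPos_add (σ : A → List A) (w' : ℕ → A) (k m : ℕ) :
    blockPos σ w' (k + m) = blockPos σ w' k + ((factorAt w' k m).flatMap σ).length := by
  simp only [blockPos, prefixOf_add, List.flatMap_append, List.length_append]

theorem blockPos_succ (σ : A → List A) (w' : ℕ → A) (k : ℕ) :
    blockPos σ w' (k + 1) = blockPos σ w' k + (σ (w' k)).length := by
  rw [blockPos_add]
  simp [factorAt]

theorem Maps.factorAt_blockPos {σ : A → List A} {w' w : ℕ → A} (h : Maps σ w' w) (k m : ℕ) :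
    factorAt w (blockPos σ w' k) ((factorAt w' k m).flatMap σ).length =
      (factorAt w' k m).flatMap σ := by
  have := h (k + m)
  rw [prefixOf_add, List.flatMap_append, IsPrefixOf.append_iff] at this
  exact this.2

theorem Maps.block {σ : A → List A} {w' w : ℕ → A} (h : Maps σ w' w) (k : ℕ) :
    factorAt w (blockPos σ w' k) (σ (w' k)).length = σ (w' k) := by
  simpa [factorAt] using h.factorAt_blockPos k 1

theorem Maps.getElem_block {σ : A → List A} {w' w : ℕ → A} (h : Maps σ w' w) (k j : ℕ)
    (hj : j < (σ (w' k)).length) : w (blockPos σ w' k + j) = (σ (w' k))[j] :=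
  (factorAt_eq_iff.1 (h.block k) j hj).symm

theorem Maps.head_eq {χ : A → List A} {w y : ℕ → A} (h : Maps χ w y) {e : A} {t : List A}
    (he : χ (w 0) = e :: t) : y 0 = e := by
  have := h.getElem_block 0 0 (by simp [he])
  simpa [he] using this

theorem blockPos_strictMono {σ : A → List A} (hσ : ∀ u, σ u ≠ []) (w' : ℕ → A) :
    StrictMono (blockPos σ w') := by
  apply strictMono_nat_of_lt_succ
  intro k
  rw [blockPos_succ]
  have := List.length_pos_iff.2 (hσ (w' k))
  omega

theorem exists_blockPos_le {σ : A → List A} (hσ : ∀ u, σ u ≠ []) (w' : ℕ → A) (N : ℕ) :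
    ∃ k, blockPos σ w' k ≤ N ∧ N < blockPos σ w' (k + 1) := by
  have hm := blockPos_strictMono hσ w'
  have hex : ∃ k, N < blockPos σ w' (k + 1) :=
    ⟨N, lt_of_lt_of_le (Nat.lt_succ_self N) (hm.id_le (N + 1))⟩
  classical
  refine ⟨Nat.find hex, ?_, Nat.find_spec hex⟩
  rcases hk : Nat.find hex with _ | k
  · simp
  · have := Nat.find_min hex (m := k) (by omega)
    omega

theorem Maps.comp {σ ρ : A → List A} {w₂ w₁ w₀ : ℕ → A} (hσ : Maps σ w₁ w₀)
    (hρ : Maps ρ w₂ w₁) : Maps (fun u => (ρ u).flatMap σ) w₂ w₀ := by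
  intro k
  have h1 : prefixOf w₁ ((prefixOf w₂ k).flatMap ρ).length = (prefixOf w₂ k).flatMap ρ := hρ k
  have h2 := hσ ((prefixOf w₂ k).flatMap ρ).length
  rw [h1, List.flatMap_assoc] at h2
  exact h2

/-- Every image under `σ` is `x` followed by a word without `x`, and the letter after that `x`
(which is `x` again if the image is just `x`) is the letter whose image it is. -/
def IsSeparating (x : A) (σ : A → List A) : Prop :=
  ∀ u, ∃ r, σ u = x :: r ∧ x ∉ r ∧ r.headD x = u

namespace IsSeparating

variable {x : A} {σ : A → List A}

theorem ne_nil (hs : IsSeparating x σ) (u : A) : σ u ≠ [] := by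
  obtain ⟨r, h, -⟩ := hs u
  simp [h]

theorem apply_blockPos (hs : IsSeparating x σ) {w' w : ℕ → A} (h : Maps σ w' w) (k : ℕ) :
    w (blockPos σ w' k) = x := by
  obtain ⟨r, hr, -⟩ := hs (w' k)
  have := h.getElem_block k 0 (by simp [hr])
  simpa [hr] using this

/-- Decoding looks one position past the start of the block. If the block is just `x`, that position
belongs to the next block, which starts with `x` as well. -/
theorem apply_blockPos_add_one (hs : IsSeparating x σ) {w' w : ℕ → A} (h : Maps σ w' w) (k : ℕ) :
    w (blockPos σ w' k + 1) = w' k := by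
  obtain ⟨r, hr, -, h3⟩ := hs (w' k)
  rcases r with _ | ⟨y, r⟩
  · have := hs.apply_blockPos h (k + 1)
    rw [blockPos_succ, hr] at this
    simp at this h3
    rw [this, h3]
  · have := h.getElem_block k 1 (by simp [hr])
    simp [hr] at this h3
    rw [this, h3]

theorem exists_blockPos (hs : IsSeparating x σ) {w' w : ℕ → A} (h : Maps σ w' w) {i : ℕ}
    (hi : w i = x) : ∃ k, i = blockPos σ w' k := by
  obtain ⟨k, h1, h2⟩ := exists_blockPos_le hs.ne_nil w' i
  refine ⟨k, ?_⟩
  by_contra hne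
  obtain ⟨j, rfl⟩ := Nat.exists_eq_add_of_le h1
  rw [blockPos_succ] at h2
  obtain ⟨r, hr, hx, -⟩ := hs (w' k)
  have hj : j < (σ (w' k)).length := by omega
  have := h.getElem_block k j hj
  rcases j with _ | j
  · simp at hne
  · simp [hr] at this
    rw [hi] at this
    exact hx (this ▸ List.getElem_mem _)

theorem exists_factorAt_eq (hs : IsSeparating x σ) {w' w : ℕ → A} (h : Maps σ w' w) {i L : ℕ}
    (hi : w i = x) (hL : w (i + L) = x) :
    ∃ k m, i = blockPos σ w' k ∧ factorAt w i L = (factorAt w' k m).flatMap σ := by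
  obtain ⟨k, hk⟩ := hs.exists_blockPos h hi
  obtain ⟨l, hl⟩ := hs.exists_blockPos h hL
  have hkl : k ≤ l := (blockPos_strictMono hs.ne_nil w').le_iff_le.1 (by omega)
  obtain ⟨m, rfl⟩ := Nat.exists_eq_add_of_le hkl
  refine ⟨k, m, hk, ?_⟩
  rw [← h.factorAt_blockPos k m, ← hk]
  rw [blockPos_add] at hl
  congr 1
  omega

theorem flatMap_injective (hs : IsSeparating x σ) :
    Function.Injective (fun c : List A => c.flatMap σ) := by
  intro c
  induction c with
  | nil =>
    rintro (_ | ⟨v, c'⟩) h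
    · rfl
    · obtain ⟨r, hr, -⟩ := hs v
      simp [hr] at h
  | cons u c ih =>
    rintro (_ | ⟨v, c'⟩) h
    · obtain ⟨r, hr, -⟩ := hs u
      simp [hr] at h
    · obtain ⟨r, hr, hx, hu⟩ := hs u
      obtain ⟨r', hr', hx', hv⟩ := hs v
      have huv : u = v := by
        simp only [List.flatMap_cons, hr, hr', List.cons_append, List.cons.injEq, true_and] at h
        have hhead : ∀ (r c : List A) , x ∉ r → (r ++ c.flatMap σ).headD x = r.headD x := by
          intro r c _
          rcases r with _ | ⟨y, r⟩
          · rcases c with _ | ⟨z, c⟩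
            · simp
            · obtain ⟨q, hq, -⟩ := hs z
              simp [hq]
          · simp
        rw [← hu, ← hv, ← hhead r c hx, ← hhead r' c' hx', h]
      subst huv
      simp only [List.flatMap_cons, List.append_cancel_left_eq] at h
      rw [ih h]

/-- Desubstitution: if the image of `w` under `χ` is the image of `y'` under a separating `σ` and
all the words `χ u` start with the separating letter, then `χ` factors through `σ`. -/
theorem factor (hs : IsSeparating x σ) {χ : A → List A} {w y y' : ℕ → A} (hχ : Maps χ w y)
    (hσ : Maps σ y' y) (hhead : ∀ u, (χ u).head? = some x) (hocc : ∀ u, ∃ k, w k = u) :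
    ∃ χ' : A → List A, (∀ u, χ u = (χ' u).flatMap σ) ∧ Maps χ' w y' := by
  have hx : ∀ k, y (blockPos χ w k) = x := by
    intro k
    have h1 := hhead (w k)
    have h2 : 0 < (χ (w k)).length := by
      rcases h : χ (w k) with _ | _
      · simp [h] at h1
      · simp
    have h3 := hχ.getElem_block k 0 h2
    rw [List.head?_eq_getElem?, List.getElem?_eq_getElem h2] at h1
    simp only [Nat.add_zero] at h3
    rw [h3]
    simpa using h1
  have hex : ∀ u, ∃ c : List A, χ u = c.flatMap σ := by
    intro u
    obtain ⟨k, rfl⟩ := hocc u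
    obtain ⟨l, m, -, h2⟩ := hs.exists_factorAt_eq hσ (hx k) (L := (χ (w k)).length)
      (by rw [← blockPos_succ]; exact hx (k + 1))
    rw [hχ.block] at h2
    exact ⟨_, h2⟩
  choose χ' hχ' using hex
  refine ⟨χ', hχ', fun k => ?_⟩
  obtain ⟨l, m, h1, h2⟩ := hs.exists_factorAt_eq hσ (i := 0) (L := blockPos χ w k)
    (by simpa using hx 0) (by simpa using hx k)
  have hl : l = 0 := by
    apply (blockPos_strictMono hs.ne_nil y').injective
    rw [← h1]; simp
  subst hl
  have h3 : ((prefixOf w k).flatMap χ').flatMap σ = (prefixOf y' m).flatMap σ := by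
    have : prefixOf y (blockPos χ w k) = (prefixOf w k).flatMap χ := hχ k
    rw [List.flatMap_assoc]
    simp only [← hχ']
    rw [← this]
    exact h2
  rw [hs.flatMap_injective h3]
  exact isPrefixOf_prefixOf _ _

end IsSeparating

end InfiniteWords

/-! ### Minimality of the pseudopalindromic closure -/

section Closure

variable {A : Type*}

theorem antimorphism_append (τ : Equiv.Perm A) (u v : List A) :
    antimorphism τ (u ++ v) = antimorphism τ v ++ antimorphism τ u := by
  simp [antimorphism]

@[simp] theorem length_antimorphism (τ : Equiv.Perm A) (u : List A) :
    (antimorphism τ u).length = u.length := by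
  simp [antimorphism]

theorem antimorphism_antimorphism {τ : Equiv.Perm A} (hτ : Function.Involutive τ) (u : List A) :
    antimorphism τ (antimorphism τ u) = u := by
  simp [antimorphism, hτ.comp_self]

theorem isPseudopalindrome_append_antimorphism {τ : Equiv.Perm A} (hτ : Function.Involutive τ)
    {s q : List A} (hq : IsPseudopalindrome τ q) :
    IsPseudopalindrome τ (s ++ q ++ antimorphism τ s) := by
  unfold IsPseudopalindrome at *
  rw [antimorphism_append, antimorphism_append, antimorphism_antimorphism hτ, hq,
    List.append_assoc]

variable [DecidableEq A]

theorem pseudoClosure_eq {τ : Equiv.Perm A} {s q : List A} (hq : IsPseudopalindrome τ q)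
    (hmin : ∀ s' q', s ++ q = s' ++ q' → s'.length < s.length → ¬ IsPseudopalindrome τ q') :
    pseudoClosure τ (s ++ q) = s ++ q ++ antimorphism τ s := by
  have hk : Nat.find (exists_pseudopalindromic_suffix τ (s ++ q)) = s.length := by
    rw [Nat.find_eq_iff]
    refine ⟨by simpa using hq, fun k hk => ?_⟩
    apply hmin ((s ++ q).take k) _ (List.take_append_drop k _).symm
    simp; omega
  simp only [pseudoClosure, hk]
  simp

theorem isPseudopalindrome_pseudoClosure {τ : Equiv.Perm A} (hτ : Function.Involutive τ)
    (u : List A) : IsPseudopalindrome τ (pseudoClosure τ u) :=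
  isPseudopalindrome_append_antimorphism hτ (Nat.find_spec (exists_pseudopalindromic_suffix τ u))

/-- If `V = u r` with `r` no longer than `u`, then the image of `r` under the antimorphism is a
prefix of `u`, and what remains of `u` is a pseudopalindromic suffix. So `r` is at least as long as
the part that the closure reflects. -/
theorem length_pseudoClosure_le {τ : Equiv.Perm A} (hτ : Function.Involutive τ) {u V : List A}
    (hV : IsPseudopalindrome τ V) (h : u <+: V) : (pseudoClosure τ u).length ≤ V.length := by
  obtain ⟨r, rfl⟩ := h
  have hlen : (pseudoClosure τ u).length =
      u.length + min (Nat.find (exists_pseudopalindromic_suffix τ u)) u.length := by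
    simp only [pseudoClosure, List.take_append_drop, List.length_append, length_antimorphism,
      List.length_take]
  rw [hlen, List.length_append]
  rcases le_total u.length r.length with hr | hr
  · omega
  · have hV' : antimorphism τ r ++ antimorphism τ u = u ++ r := by
      rw [← antimorphism_append]; exact hV
    obtain ⟨q, hq⟩ : antimorphism τ r <+: u :=
      List.prefix_of_prefix_length_le ⟨_, hV'⟩ (List.prefix_append u r) (by simpa using hr)
    have hpal : IsPseudopalindrome τ q := by
      have h1 : antimorphism τ u = antimorphism τ q ++ r := by
        rw [← hq, antimorphism_append, antimorphism_antimorphism hτ]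
      rw [h1] at hV'
      have h2 : antimorphism τ r ++ (antimorphism τ q ++ r) = antimorphism τ r ++ (q ++ r) := by
        rw [hV', ← List.append_assoc, hq]
      exact List.append_cancel_right (List.append_cancel_left h2)
    have hd : u.drop r.length = q := by
      rw [← hq]
      simp
    have := Nat.find_min' (exists_pseudopalindromic_suffix τ u) (m := r.length)
      (by rw [hd]; exact hpal)
    omega

theorem isPseudopalindrome_pseudoPal {τ : Equiv.Perm A} (hτ : Function.Involutive τ)
    (v : List A) : IsPseudopalindrome τ (pseudoPal τ v) := by
  rcases List.eq_nil_or_concat v with rfl | ⟨v, x, rfl⟩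
  · simp [pseudoPal, IsPseudopalindrome, antimorphism]
  · rw [List.concat_eq_append, pseudoPal_append_singleton]
    exact isPseudopalindrome_pseudoClosure hτ _

theorem pseudoPal_prefix_concat (τ : Equiv.Perm A) (v : List A) (x : A) :
    pseudoPal τ v ++ [x] <+: pseudoPal τ (v ++ [x]) := by
  rw [pseudoPal_append_singleton]
  exact prefix_pseudoClosure τ _

theorem pseudoPal_prefix {τ : Equiv.Perm A} {u v : List A} (h : u <+: v) :
    pseudoPal τ u <+: pseudoPal τ v := by
  obtain ⟨r, rfl⟩ := h
  induction r using List.reverseRecOn with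
  | nil => simp
  | append_singleton r x ih =>
    rw [← List.append_assoc]
    exact ih.trans ((List.prefix_append _ _).trans (pseudoPal_prefix_concat τ _ x))

/-- Minimality of the closure leaves no pseudopalindromic prefix strictly between two successive
iterates. -/
theorem exists_eq_pseudoPal_of_prefix {τ : Equiv.Perm A} (hτ : Function.Involutive τ)
    {v Q : List A} (hQ : IsPseudopalindrome τ Q) (h : Q <+: pseudoPal τ v) :
    ∃ u, u <+: v ∧ Q = pseudoPal τ u := by
  induction v using List.reverseRecOn with
  | nil => exact ⟨[], List.prefix_rfl, by simpa [pseudoPal] using h⟩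
  | append_singleton v x ih =>
    have hP := pseudoPal_prefix_concat τ v x
    rcases le_or_gt Q.length (pseudoPal τ v).length with hl | hl
    · obtain ⟨u, h1, h2⟩ := ih (List.prefix_of_prefix_length_le h
        ((List.prefix_append _ _).trans hP) hl)
      exact ⟨u, h1.trans (List.prefix_append _ _), h2⟩
    · refine ⟨v ++ [x], List.prefix_rfl, h.eq_of_length_le ?_⟩
      rw [pseudoPal_append_singleton]
      apply length_pseudoClosure_le hτ hQ
      exact List.prefix_of_prefix_length_le hP h (by simp; omega)

end Closure

/-! ### Justin's formula and the tower of episturmian words -/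

section Episturmian

variable {A : Type*} [DecidableEq A]

/-- The elementary episturmian morphism of the letter `x`. -/
def psi (x u : A) : List A := if u = x then [x] else [x, u]

/-- The substitution with `Pal_τ = mu τ ∘ Pal_1`. -/
def mu (τ : Equiv.Perm A) (u : A) : List A := if τ u = u then [u] else [u, τ u]

/-- The iterated palindromic closure, computed from the left by Justin's formula. -/
def epal : List A → List A
  | [] => []
  | x :: v => (epal v).flatMap (psi x) ++ [x]

@[simp] theorem psi_self (x : A) : psi x x = [x] := by simp [psi]

theorem psi_of_ne {x u : A} (h : u ≠ x) : psi x u = [x, u] := by simp [psi, h]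

theorem isSeparating_psi (x : A) : IsSeparating x (psi x) := by
  intro u
  by_cases h : u = x
  · subst h; exact ⟨[], by simp⟩
  · exact ⟨[u], by simp [psi_of_ne h, Ne.symm h]⟩

theorem epal_concat_of_notMem {v : List A} {x : A} (h : x ∉ v) :
    epal (v ++ [x]) = epal v ++ [x] ++ epal v := by
  induction v with
  | nil => simp [epal]
  | cons y v ih =>
    simp only [List.mem_cons, not_or] at h
    simp [epal, ih h.2, psi_of_ne h.1]

/-- A word starting with blocks of `psi x`, read after cutting off the first letter `x`. -/
theorem exists_flatMap_psi_concat (x : A) (D : List A) :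
    ∃ E, D.flatMap (psi x) ++ [x] = x :: E := by
  rcases D with _ | ⟨u, D⟩
  · simp
  · by_cases h : u = x
    · subst h; simp
    · simp [psi_of_ne h]

/-- This turns the recursion from the left into one from the right: appending `x` repeats what has
been added since just before the last `x`. A letter `y` in front replaces `D` by its conjugate `E`,
where ψ_y(D) y = y E. -/
theorem epal_concat_of_split (v₁ v₂ : List A) {x : A} (h : x ∉ v₂) :
    ∃ D, epal (v₁ ++ x :: v₂) = epal v₁ ++ D ∧ epal (v₁ ++ x :: v₂ ++ [x]) =
      epal (v₁ ++ x :: v₂) ++ D := by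
  induction v₁ with
  | nil =>
    refine ⟨epal (x :: v₂), by simp [epal], ?_⟩
    simp [epal, epal_concat_of_notMem h]
  | cons y v₁ ih =>
    obtain ⟨D, h1, h2⟩ := ih
    obtain ⟨E, hE⟩ := exists_flatMap_psi_concat y D
    refine ⟨E, ?_, ?_⟩
    · simp only [List.cons_append, epal, h1, List.flatMap_append, List.append_assoc, hE]
      simp
    · have h3 : epal (y :: v₁ ++ x :: v₂) = (epal v₁).flatMap (psi y) ++ y :: E := by
        simp only [List.cons_append, epal, h1, List.flatMap_append, List.append_assoc, hE]
      rw [h3]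
      change (epal (v₁ ++ x :: v₂ ++ [x])).flatMap (psi y) ++ [y] = _
      rw [h2, h1]
      simp only [List.flatMap_append, List.append_assoc, hE]
      have : ∀ l, D.flatMap (psi y) ++ (y :: l) = y :: E ++ l := by
        intro l
        rw [← hE]; simp
      rw [this]

theorem exists_last_split {v : List A} {x : A} (h : x ∈ v) :
    ∃ v₁ v₂, v = v₁ ++ x :: v₂ ∧ x ∉ v₂ := by
  induction v using List.reverseRecOn with
  | nil => simp at h
  | append_singleton v y ih =>
    by_cases hy : y = x
    · subst hy; exact ⟨v, [], by simp⟩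
    · have hx : x ∈ v := by
        simp only [List.mem_append, List.mem_singleton] at h
        exact h.resolve_right (fun e => hy e.symm)
      obtain ⟨v₁, v₂, h1, h2⟩ := ih hx
      refine ⟨v₁, v₂ ++ [y], by simp [h1], ?_⟩
      simp [h2, Ne.symm hy]

/-- A pseudopalindromic suffix of Pal(v)x of length at least 2 is τ(x) Q x with `Q` a
pseudopalindrome. Reflected in Pal(v), `Q x` becomes a prefix, so Q = Pal(u) with `ux` a prefix of
`v`. The longest such suffix comes from the last `x` in `v`, and the closure then appends exactly
what `epal_concat_of_split` appends. If `x` is new, the suffix is `x` or empty, according to whether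
τ fixes `x`. -/
theorem pseudoPal_eq_epal {τ : Equiv.Perm A} (hτ : Function.Involutive τ) (v : List A) :
    pseudoPal τ v = (epal v).flatMap (mu τ) := by
  induction hn : v.length using Nat.strong_induction_on generalizing v with
  | _ n ih =>
  subst hn
  rcases List.eq_nil_or_concat v with rfl | ⟨v, x, rfl⟩
  · simp [pseudoPal, epal]
  rw [List.concat_eq_append] at *
  have ihv : ∀ u, u <+: v → pseudoPal τ u = (epal u).flatMap (mu τ) := fun u hu =>
    ih _ (by have := hu.length_le; simp; omega) u rfl
  have hP := isPseudopalindrome_pseudoPal hτ v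
  -- longer pseudopalindromic suffixes come from prefixes of `v` followed by `x`
  have key : ∀ s' q', pseudoPal τ v ++ [x] = s' ++ q' → IsPseudopalindrome τ q' →
      2 ≤ q'.length → ∃ u, u ++ [x] <+: v ∧ q'.length = (pseudoPal τ u).length + 2 := by
    intro s' q' h hq hl
    rcases List.eq_nil_or_concat q' with rfl | ⟨q₁, y, rfl⟩
    · simp at hl
    rw [List.concat_eq_append, ← List.append_assoc] at h
    obtain ⟨h1, h2⟩ := List.append_inj' h rfl
    simp only [List.cons.injEq, and_true] at h2
    subst h2
    rw [List.concat_eq_append] at hq hl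
    rcases q₁ with _ | ⟨z, Q⟩
    · simp at hl
    have h3 : antimorphism τ [x] ++ antimorphism τ Q ++ antimorphism τ [z] = z :: Q ++ [x] := by
      rw [← antimorphism_append, ← antimorphism_append]
      exact hq
    obtain ⟨h4, h5⟩ := List.append_inj' h3 rfl
    simp only [antimorphism, List.map_cons, List.map_nil, List.reverse_singleton,
      List.cons.injEq, and_true, List.singleton_append] at h4 h5
    have hQ : IsPseudopalindrome τ Q := h4.2
    have h6 : Q ++ [x] <+: pseudoPal τ v := by
      rw [← hP, h1]
      refine ⟨antimorphism τ s', ?_⟩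
      rw [antimorphism_append]
      have : antimorphism τ (z :: Q) = antimorphism τ Q ++ [τ z] := by simp [antimorphism]
      rw [this, hQ, h5]
    obtain ⟨u, hu, rfl⟩ := exists_eq_pseudoPal_of_prefix hτ hQ ((List.prefix_append _ _).trans h6)
    refine ⟨u, ?_, by simp⟩
    obtain ⟨_ | ⟨y, t⟩, rfl⟩ := hu
    · have := h6.length_le
      simp at this
    · have h7 : pseudoPal τ u ++ [y] <+: pseudoPal τ (u ++ y :: t) :=
        (pseudoPal_prefix_concat τ u y).trans (pseudoPal_prefix (by simp))
      have := (List.prefix_of_prefix_length_le h6 h7 (by simp)).eq_of_length (by simp)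
      simp at this
      subst this
      simp
  rw [pseudoPal_append_singleton]
  by_cases hx : x ∈ v
  · obtain ⟨v₁, v₂, rfl, hx₂⟩ := exists_last_split hx
    obtain ⟨D, h1, h2⟩ := epal_concat_of_split v₁ v₂ hx₂
    have e1 := ihv v₁ (by simp)
    have e2 := ihv _ List.prefix_rfl
    rw [h1, List.flatMap_append, ← e1] at e2
    set E := D.flatMap (mu τ) with hE
    have h3 : pseudoPal τ v₁ ++ [x] <+: pseudoPal τ (v₁ ++ x :: v₂) :=
      (pseudoPal_prefix_concat τ v₁ x).trans (pseudoPal_prefix (by simp))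
    obtain ⟨E', hE'⟩ : ∃ E', E = x :: E' := by
      rw [e2, List.prefix_append_right_inj] at h3
      obtain ⟨E', h⟩ := h3
      exact ⟨E', by simpa using h.symm⟩
    have hv₁ := isPseudopalindrome_pseudoPal hτ v₁
    have e3 : pseudoPal τ (v₁ ++ x :: v₂) ++ [x] =
        antimorphism τ E' ++ (τ x :: pseudoPal τ v₁ ++ [x]) := by
      rw [← hP, e2, antimorphism_append, hv₁, hE']
      simp [antimorphism]
    rw [e3, pseudoClosure_eq]
    · rw [← e3, antimorphism_antimorphism hτ, h2, List.flatMap_append, ← hE, hE',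
        ← ihv _ List.prefix_rfl]
      simp
    · have h0 : antimorphism τ (pseudoPal τ v₁) = pseudoPal τ v₁ := hv₁
      have : τ x :: pseudoPal τ v₁ ++ [x] = [τ x] ++ pseudoPal τ v₁ ++ [x] := by simp
      rw [this]
      unfold IsPseudopalindrome
      rw [antimorphism_append, antimorphism_append, h0]
      simp [antimorphism, hτ x]
    · intro s' q' h hl hq
      rw [← e3] at h
      have hlen := congrArg List.length e3
      have hlen' := congrArg List.length h
      simp only [List.length_append, List.length_cons, List.length_nil, length_antimorphism]
        at hlen hlen' hl
      obtain ⟨u, hu, hul⟩ := key s' q' h hq (by omega)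
      -- A longer `u` would make the `x` after it an occurrence in `v₂`.
      have hle : u.length ≤ v₁.length := by
        by_contra hlt
        have hv : v₁ ++ [x] <+: v₁ ++ x :: v₂ := by simp
        obtain ⟨t, rfl⟩ := List.prefix_of_prefix_length_le hv
          ((List.prefix_append _ _).trans hu) (by simp; omega)
        simp only [List.append_assoc, List.prefix_append_right_inj, List.cons_append,
          List.cons_prefix_cons, true_and] at hu
        exact hx₂ (hu.subset (by simp))
      have := (pseudoPal_prefix (τ := τ) (List.prefix_of_prefix_length_le
        ((List.prefix_append _ _).trans hu) (List.prefix_append _ _) hle)).length_le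
      omega
  · have hno : ∀ s' q', pseudoPal τ v ++ [x] = s' ++ q' → IsPseudopalindrome τ q' →
        ¬ 2 ≤ q'.length := by
      intro s' q' h hq hl
      obtain ⟨u, hu, -⟩ := key s' q' h hq hl
      exact hx (hu.subset (by simp))
    rw [epal_concat_of_notMem hx, List.flatMap_append, List.flatMap_append,
      ← ihv v List.prefix_rfl]
    have hP' : antimorphism τ (pseudoPal τ v) = pseudoPal τ v := hP
    by_cases hτx : τ x = x
    · rw [pseudoClosure_eq, hP']
      · simp [mu, hτx]
      · simp [IsPseudopalindrome, antimorphism, hτx]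
      · intro s' q' h hl hq
        have hlen := congrArg List.length h
        simp at hlen
        exact hno s' q' h hq (by omega)
    · have := pseudoClosure_eq (τ := τ) (s := pseudoPal τ v ++ [x]) (q := [])
        (by simp [IsPseudopalindrome, antimorphism]) (by
          intro s' q' h hl hq
          rw [List.append_nil] at h
          have hlen := congrArg List.length h
          simp at hlen hl
          have h1 : q'.length = 1 := by
            have := hno s' q' h hq
            omega
          obtain ⟨y, rfl⟩ := List.length_eq_one_iff.1 h1
          obtain ⟨-, h3⟩ := List.append_inj' h rfl
          simp only [List.cons.injEq, and_true] at h3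
          subst h3
          simp [IsPseudopalindrome, antimorphism] at hq
          exact hτx hq)
      rw [List.append_nil, antimorphism_append, hP'] at this
      rw [this]
      simp [mu, hτx, antimorphism]

theorem mu_ne_nil (τ : Equiv.Perm A) (u : A) : mu τ u ≠ [] := by
  unfold mu; split <;> simp

theorem psi_ne_nil (x u : A) : psi x u ≠ [] := (isSeparating_psi x).ne_nil u

theorem isPrefixOf_epal (Δ : ℕ → A) (k : ℕ) :
    IsPrefixOf (epal (prefixOf Δ k)) (pseudoIPal 1 Δ) := by
  have h := isPrefixOf_pseudoIPal 1 Δ k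
  rw [pseudoPal_eq_epal (fun x => rfl)] at h
  have : mu (1 : Equiv.Perm A) = fun u => [u] := by funext u; simp [mu]
  simpa [this] using h

theorem length_le_epal (v : List A) : v.length ≤ (epal v).length := by
  induction v with
  | nil => simp
  | cons x v ih =>
    have := flatMap_length_ge (psi_ne_nil x) (epal v)
    simp only [epal, List.length_append, List.length_cons, List.length_nil]
    omega

theorem prefixOf_prefix_epal (Δ : ℕ → A) (k : ℕ) :
    prefixOf (pseudoIPal 1 Δ) k <+: epal (prefixOf Δ k) :=
  (isPrefixOf_prefixOf _ k).prefix_of_le (isPrefixOf_epal Δ k)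
    (by simpa using length_le_epal (prefixOf Δ k))

theorem maps_mu (τ : Equiv.Perm A) (hτ : Function.Involutive τ) (Δ : ℕ → A) :
    Maps (mu τ) (pseudoIPal 1 Δ) (pseudoIPal τ Δ) := by
  intro k
  have h := isPrefixOf_pseudoIPal τ Δ k
  rw [pseudoPal_eq_epal hτ] at h
  exact h.of_prefix (flatMap_prefix (prefixOf_prefix_epal Δ k) _)

theorem maps_psi (Δ : ℕ → A) :
    Maps (psi (Δ 0)) (pseudoIPal 1 (fun i => Δ (i + 1))) (pseudoIPal 1 Δ) := by
  intro k
  have h := isPrefixOf_epal Δ (k + 1)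
  have e : prefixOf Δ (k + 1) = Δ 0 :: prefixOf (fun i => Δ (i + 1)) k := by
    simp [prefixOf, factorAt, List.range_succ_eq_map, Function.comp_def]
  rw [e, epal] at h
  exact h.of_prefix ((flatMap_prefix (prefixOf_prefix_epal _ k) _).trans (List.prefix_append _ _))

/-- The standard episturmian word directed by `s` without its first `j` letters. -/
def level (s : ℕ → A) (j : ℕ) : ℕ → A := pseudoIPal 1 (fun i => s (j + i))

/-- The substitution that maps `level s p` to `pseudoIPal τ s`. -/
def levelSubst (τ : Equiv.Perm A) (s : ℕ → A) : ℕ → A → List A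
  | 0 => mu τ
  | p + 1 => fun u => (psi (s p) u).flatMap (levelSubst τ s p)

theorem maps_level (s : ℕ → A) (j : ℕ) : Maps (psi (s j)) (level s (j + 1)) (level s j) := by
  have h := maps_psi (fun i => s (j + i))
  have e : (fun i => s (j + (i + 1))) = fun i => s (j + 1 + i) := by
    funext i; congr 1; omega
  simp only [e] at h
  exact h

theorem maps_levelSubst (τ : Equiv.Perm A) (hτ : Function.Involutive τ) (s : ℕ → A) (j : ℕ) :
    Maps (levelSubst τ s j) (level s j) (pseudoIPal τ s) := by
  induction j with
  | zero =>
    have := maps_mu τ hτ s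
    simpa [level, levelSubst] using this
  | succ j ih => exact ih.comp (maps_level s j)

theorem levelSubst_ne_nil (τ : Equiv.Perm A) (s : ℕ → A) (p : ℕ) (u : A) :
    levelSubst τ s p u ≠ [] := by
  induction p generalizing u with
  | zero => exact mu_ne_nil τ u
  | succ p ih =>
    obtain ⟨r, hr, -⟩ := isSeparating_psi (s p) u
    simp [levelSubst, hr, ih]

end Episturmian

/-! ### The fixed point: first blocks, recurrence, separated letters -/

section FixedPoint

variable {A : Type*} [DecidableEq A]

/-- `s` is the fixed point of `IPal` for the exchange of `b` and `c` that begins with `a ^ n b`. -/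
structure IsFixedPointFor (a b c : A) (n : ℕ) (s : ℕ → A) : Prop where
  hab : a ≠ b
  hac : a ≠ c
  hbc : b ≠ c
  cover : ∀ x : A, x = a ∨ x = b ∨ x = c
  one_le : 1 ≤ n
  fixed : pseudoIPal (Equiv.swap b c) s = s
  pre : IsPrefixOf (List.replicate n a ++ [b]) s

theorem involutive_swap (b c : A) : Function.Involutive (Equiv.swap b c) :=
  fun x => Equiv.swap_apply_self b c x

namespace IsFixedPointFor

variable {a b c : A} {n : ℕ} {s : ℕ → A}

theorem apply_lt (h : IsFixedPointFor a b c n s) {i : ℕ} (hi : i < n) : s i = a := by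
  have := isPrefixOf_iff.1 h.pre i (by simp; omega)
  rw [← this, List.getElem_append_left (by simpa using hi)]
  simp

theorem apply_zero (h : IsFixedPointFor a b c n s) : s 0 = a := h.apply_lt h.one_le

theorem apply_eq (h : IsFixedPointFor a b c n s) : s n = b := by
  have := isPrefixOf_iff.1 h.pre n (by simp)
  rw [← this]
  simp

theorem maps_subst (h : IsFixedPointFor a b c n s) (j : ℕ) :
    Maps (levelSubst (Equiv.swap b c) s j) (level s j) s := by
  have := maps_levelSubst (Equiv.swap b c) (involutive_swap b c) s j
  rwa [h.fixed] at this

theorem subst_a (h : IsFixedPointFor a b c n s) {j : ℕ} (hj : j ≤ n) :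
    levelSubst (Equiv.swap b c) s j a = [a] := by
  induction j with
  | zero => simp [levelSubst, mu, Equiv.swap_apply_of_ne_of_ne h.hab h.hac]
  | succ j ih => simp [levelSubst, h.apply_lt (i := j) (by omega), ih (by omega)]

theorem subst_b (h : IsFixedPointFor a b c n s) {j : ℕ} (hj : j ≤ n) :
    levelSubst (Equiv.swap b c) s j b = List.replicate j a ++ [b, c] := by
  induction j with
  | zero => simp [levelSubst, mu, h.hbc.symm]
  | succ j ih =>
    simp [levelSubst, h.apply_lt (i := j) (by omega), ih (by omega), psi_of_ne h.hab.symm,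
      h.subst_a (j := j) (by omega), List.replicate_succ]

theorem subst_c (h : IsFixedPointFor a b c n s) {j : ℕ} (hj : j ≤ n) :
    levelSubst (Equiv.swap b c) s j c = List.replicate j a ++ [c, b] := by
  induction j with
  | zero => simp [levelSubst, mu, h.hbc]
  | succ j ih =>
    simp [levelSubst, h.apply_lt (i := j) (by omega), ih (by omega), psi_of_ne h.hac.symm,
      h.subst_a (j := j) (by omega), List.replicate_succ]

theorem isSeparating_subst_one (h : IsFixedPointFor a b c n s) :
    IsSeparating a (levelSubst (Equiv.swap b c) s 1) := by
  intro u
  rcases h.cover u with rfl | rfl | rfl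
  · exact ⟨[], by simp [h.subst_a h.one_le]⟩
  · exact ⟨[u, c], by simp [h.subst_b h.one_le, h.hab, h.hac]⟩
  · exact ⟨[u, b], by simp [h.subst_c h.one_le, h.hab, h.hac]⟩

/-- As s_n = b, every ψ_b-image starts with `b`, whose own image one level lower is a^n b c. All
three letters thus occur in every block of level n + 1. -/
theorem prefix_subst (h : IsFixedPointFor a b c n s) (u : A) :
    List.replicate n a ++ [b, c] <+: levelSubst (Equiv.swap b c) s (n + 1) u := by
  rw [← h.subst_b le_rfl]
  simp only [levelSubst, h.apply_eq]
  by_cases hu : u = b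
  · simp [hu]
  · simp [psi_of_ne hu]

theorem mem_subst (h : IsFixedPointFor a b c n s) (u y : A) :
    y ∈ levelSubst (Equiv.swap b c) s (n + 1) u := by
  apply (h.prefix_subst u).subset
  have := h.one_le
  rcases h.cover y with rfl | rfl | rfl <;> (simp; try omega)

theorem exists_gap (h : IsFixedPointFor a b c n s) :
    ∃ G, ∀ m y, ∃ i, m ≤ i ∧ i < m + G ∧ s i = y := by
  obtain ⟨σ, hm, hmem, hne⟩ : ∃ σ, Maps σ (level s (n + 1)) s ∧ (∀ u y, y ∈ σ u) ∧
      ∀ u, σ u ≠ [] := ⟨_, h.maps_subst (n + 1), h.mem_subst, levelSubst_ne_nil _ s _⟩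
  obtain ⟨B, hB⟩ : ∃ B, ∀ u, (σ u).length ≤ B := by
    refine ⟨(σ a).length + (σ b).length + (σ c).length, fun u => ?_⟩
    rcases h.cover u with rfl | rfl | rfl <;> omega
  -- The block after the one containing position `m` is complete before position m + 2B.
  refine ⟨2 * B, fun m y => ?_⟩
  obtain ⟨k, h1, h2⟩ := exists_blockPos_le hne (level s (n + 1)) m
  obtain ⟨j, hj, hy⟩ := List.getElem_of_mem (hmem (level s (n + 1) (k + 1)) y)
  have h3 := hm.getElem_block (k + 1) j hj
  rw [hy] at h3
  refine ⟨_, ?_, ?_, h3⟩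
  · omega
  · have h4 := blockPos_succ σ (level s (n + 1)) k
    have h5 := hB (level s (n + 1) k)
    have h6 := hB (level s (n + 1) (k + 1))
    omega

theorem exists_apply_eq (h : IsFixedPointFor a b c n s) (m : ℕ) (y : A) : ∃ i, m ≤ i ∧ s i = y := by
  obtain ⟨G, hG⟩ := h.exists_gap
  obtain ⟨i, h1, -, h2⟩ := hG m y
  exact ⟨i, h1, h2⟩

end IsFixedPointFor

theorem exists_pseudoIPal_eq_directive (Δ : ℕ → A) (i : ℕ) : ∃ k, pseudoIPal 1 Δ k = Δ i := by
  have h := isPrefixOf_epal Δ (i + 1)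
  have hmem : Δ i ∈ epal (prefixOf Δ (i + 1)) := by
    have : ∀ v : List A, ∀ x ∈ v, x ∈ epal v := by
      intro v
      induction v with
      | nil => simp
      | cons y v ih =>
        intro x hx
        simp only [epal, List.mem_append, List.mem_singleton]
        rcases List.mem_cons.1 hx with rfl | hx
        · exact Or.inr rfl
        · left
          rw [List.mem_flatMap]
          refine ⟨x, ih x hx, ?_⟩
          unfold psi; split <;> simp_all
    exact this _ _ (mem_prefixOf.2 ⟨i, by omega, rfl⟩)
  obtain ⟨k, hk, he⟩ := List.getElem_of_mem hmem
  exact ⟨k, by rw [← isPrefixOf_iff.1 h k hk, he]⟩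

theorem IsFixedPointFor.exists_level_eq {a b c : A} {n : ℕ} {s : ℕ → A}
    (h : IsFixedPointFor a b c n s) (j : ℕ) (y : A) : ∃ k, level s j k = y := by
  obtain ⟨i, h1, rfl⟩ := h.exists_apply_eq j y
  obtain ⟨i, rfl⟩ := Nat.exists_eq_add_of_le h1
  exact exists_pseudoIPal_eq_directive (fun i => s (j + i)) i

theorem level_zero_eq (s : ℕ → A) (j : ℕ) : level s j 0 = s j := by
  have := (isSeparating_psi (s j)).apply_blockPos (maps_level s j) 0
  simpa using this

/-- Among two consecutive letters, one is the separating letter. -/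
theorem level_separated (s : ℕ → A) (j i : ℕ) (h : level s j i ≠ s j) :
    0 < i ∧ level s j (i - 1) = s j ∧ level s j (i + 1) = s j := by
  have hs := isSeparating_psi (s j)
  have hm := maps_level s j
  obtain ⟨k, h1, h2⟩ := exists_blockPos_le hs.ne_nil (level s (j + 1)) i
  have h3 : i ≠ blockPos (psi (s j)) (level s (j + 1)) k := by
    rintro rfl
    exact h (hs.apply_blockPos hm k)
  have h4 := blockPos_succ (psi (s j)) (level s (j + 1)) k
  have h5 : (psi (s j) (level s (j + 1) k)).length ≤ 2 := by
    unfold psi; split <;> simp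
  have h6 : i = blockPos (psi (s j)) (level s (j + 1)) k + 1 := by omega
  have h7 : i + 1 = blockPos (psi (s j)) (level s (j + 1)) (k + 1) := by omega
  refine ⟨by omega, ?_, ?_⟩
  · rw [h6, Nat.add_sub_cancel]; exact hs.apply_blockPos hm k
  · rw [h7]; exact hs.apply_blockPos hm (k + 1)

end FixedPoint

/-! ### Runs, weights and desubstitution of a run -/

section Periods

variable {A : Type*}

/-- The factor of length `L` of `w` at position `i` has the period `p`. -/
def HasPeriodOn (w : ℕ → A) (i L p : ℕ) : Prop := ∀ j, j + p < L → w (i + j) = w (i + j + p)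

/-- The total weight of the factor of length `L` of `w` at position `i`. -/
def weight (α : A → ℕ) (w : ℕ → A) (i L : ℕ) : ℕ := ((factorAt w i L).map α).sum

theorem weight_add (α : A → ℕ) (w : ℕ → A) (i k l : ℕ) :
    weight α w i (k + l) = weight α w i k + weight α w (i + k) l := by
  simp [weight, factorAt_add]

theorem weight_one (α : A → ℕ) (w : ℕ → A) (i : ℕ) : weight α w i 1 = α (w i) := by
  simp [weight, factorAt]

theorem weight_mono (α : A → ℕ) (w : ℕ → A) (i : ℕ) {k l : ℕ} (h : k ≤ l) :
    weight α w i k ≤ weight α w i l := by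
  obtain ⟨m, rfl⟩ := Nat.exists_eq_add_of_le h
  rw [weight_add]; omega

theorem weight_const {α : A → ℕ} {w : ℕ → A} {i L : ℕ} {y : A} (h : ∀ j < L, w (i + j) = y) :
    weight α w i L = L * α y := by
  have : factorAt w i L = List.replicate L y := by
    apply List.ext_getElem
    · simp
    · intro j h1 h2
      simp at h1
      simp [h j h1]
  simp [weight, this]

theorem weight_congr {α : A → ℕ} {w : ℕ → A} {i i' L : ℕ}
    (h : ∀ j < L, w (i + j) = w (i' + j)) : weight α w i L = weight α w i' L := by
  have : factorAt w i L = factorAt w i' L := by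
    apply List.ext_getElem
    · simp
    · intro j h1 h2
      simp at h1
      simp [h j h1]
  simp [weight, this]

theorem le_weight (α : A → ℕ) (w : ℕ → A) {i L j : ℕ} (h : j < L) :
    α (w (i + j)) ≤ weight α w i L := by
  obtain ⟨m, rfl⟩ : ∃ m, L = j + 1 + m := Nat.exists_eq_add_of_le h
  rw [weight_add, weight_add, weight_one]; omega

theorem add_le_weight (α : A → ℕ) (w : ℕ → A) {i L j k : ℕ} (hjk : j < k) (h : k < L) :
    α (w (i + j)) + α (w (i + k)) ≤ weight α w i L := by
  obtain ⟨m, rfl⟩ : ∃ m, L = k + m := Nat.exists_eq_add_of_le h.le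
  rw [weight_add]
  have h1 := le_weight α w (i := i) hjk
  have h2 := le_weight α w (i := i + k) (L := m) (j := 0) (by omega)
  simp only [Nat.add_zero] at h2
  omega

theorem Maps.weight_eq {σ : A → List A} {w' w : ℕ → A} (h : Maps σ w' w) (α : A → ℕ)
    {k m i L : ℕ} (hi : i = blockPos σ w' k) (hL : i + L = blockPos σ w' (k + m)) :
    weight α w i L = weight (fun u => ((σ u).map α).sum) w' k m := by
  have h1 := h.factorAt_blockPos k m
  rw [← hi] at h1
  have h2 : L = ((factorAt w' k m).flatMap σ).length := by
    rw [blockPos_add] at hL; omega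
  rw [← h2] at h1
  rw [weight, h1, weight, List.map_flatMap, List.flatMap, List.sum_flatten, List.map_map]
  rfl

namespace HasPeriodOn

theorem weight_le_two_mul {w : ℕ → A} {i L p : ℕ} (h : HasPeriodOn w i L p) (α : A → ℕ)
    (hp : p ≤ L) (hL : L ≤ 2 * p) : weight α w i L ≤ 2 * weight α w i p := by
  obtain ⟨m, rfl⟩ := Nat.exists_eq_add_of_le hp
  have h1 : weight α w (i + p) m = weight α w i m := by
    apply weight_congr
    intro j hj
    rw [h j (by omega)]
    congr 1; omega
  have h2 := weight_mono α w i (k := m) (l := p) (by omega)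
  rw [weight_add]; omega

theorem const {w : ℕ → A} {i L p : ℕ} (h : HasPeriodOn w i L p) (hp : 1 ≤ p) {y : A}
    (hy : ∀ j < p, w (i + j) = y) : ∀ j < L, w (i + j) = y := by
  intro j
  induction j using Nat.strong_induction_on with
  | _ j ih =>
  intro hj
  rcases lt_or_ge j p with hjp | hjp
  · exact hy j hjp
  · have h1 := h (j - p) (by omega)
    rw [ih (j - p) (by omega) (by omega)] at h1
    rw [h1]
    congr 1; omega

/-- A run can be extended to the left up to an occurrence of the separating letter. -/
theorem exists_extension {w : ℕ → A} {x : A} (hx : ∀ m, w m ≠ x → 0 < m)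
    (hleft : ∀ m m', w m ≠ x → w m = w m' → w (m + 1) = w (m' + 1) → w (m - 1) = w (m' - 1))
    {p : ℕ} (hp : 1 ≤ p) (α : A → ℕ) (i : ℕ) :
    ∀ L, p + 2 ≤ L → HasPeriodOn w i L p → ∃ i₀ M, w i₀ = x ∧ i₀ + M = i + L ∧ L ≤ M ∧
      HasPeriodOn w i₀ M p ∧ weight α w i₀ p = weight α w i p := by
  induction i with
  | zero =>
    intro L hL h
    refine ⟨0, L, ?_, rfl, le_rfl, h, rfl⟩
    by_contra hne
    exact absurd (hx 0 hne) (lt_irrefl 0)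
  | succ i ih =>
    intro L hL h
    by_cases hi : w (i + 1) = x
    · exact ⟨i + 1, L, hi, rfl, le_rfl, h, rfl⟩
    · have h0 := h 0 (by omega)
      have h1 := h 1 (by omega)
      have hl := hleft (i + 1) (i + 1 + p) hi h0 (by rw [h1]; congr 1; omega)
      have hl' : w i = w (i + p) := by
        simp only [Nat.add_sub_cancel] at hl
        rw [hl]; congr 1; omega
      obtain ⟨i₀, M, h2, h3, h4, h5, h6⟩ := ih (L + 1) (by omega) (by
        intro j hj
        rcases j with _ | j
        · exact hl'
        · have := h j (by omega)
          rw [show i + (j + 1) = i + 1 + j by omega]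
          exact this)
      refine ⟨i₀, M, h2, by omega, by omega, h5, h6.trans ?_⟩
      have e1 := weight_add α w i 1 p
      have e2 := weight_add α w i p 1
      rw [weight_one] at e1 e2
      rw [Nat.add_comm 1 p, e2, hl'] at e1
      omega

/-- Desubstitution of a run that starts with the separating letter. -/
theorem exists_desubst {x : A} {σ : A → List A} (hs : IsSeparating x σ) {w' w : ℕ → A}
    (hm : Maps σ w' w) {i L p : ℕ} (h : HasPeriodOn w i L p) (hp : 1 ≤ p) (hL : p + 2 ≤ L)
    (hi : w i = x) (hne : ∃ j < p, w (i + j) ≠ x) (α : A → ℕ) :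
    ∃ k L' p', 1 ≤ p' ∧ p' < p ∧ p' ≤ L' ∧ HasPeriodOn w' k L' p' ∧
      weight α w i L ≤ weight (fun u => ((σ u).map α).sum) w' k L' + α x ∧
      weight α w i p = weight (fun u => ((σ u).map α).sum) w' k p' := by
  have hmono := blockPos_strictMono hs.ne_nil w'
  obtain ⟨k, hk⟩ := hs.exists_blockPos hm hi
  have hip : w (i + p) = x := by rw [← hi]; exact (h 0 (by omega)).symm
  obtain ⟨l, hl⟩ := hs.exists_blockPos hm hip
  have hkl : k < l := hmono.lt_iff_lt.1 (by omega)
  obtain ⟨p', rfl⟩ := Nat.exists_eq_add_of_le hkl.le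
  -- The letter of a block is read one position after its start, so blocks starting up to i + L - 2
  -- are decoded inside the run. The last of them ends at i + L - 1 or later, so at most one letter
  -- `x` of the run is lost.
  obtain ⟨q, h1, h2⟩ := exists_blockPos_le hs.ne_nil w' (i + L - 2)
  have hkq : k + p' ≤ q := by
    by_contra hlt
    have := hmono.monotone (show q + 1 ≤ k + p' by omega)
    omega
  obtain ⟨m, rfl⟩ := Nat.exists_eq_add_of_le (show k ≤ q by omega)
  have hpp : p' < p := by
    by_contra hge
    obtain ⟨j, hj, hne⟩ := hne
    apply hne
    have e : i + j = blockPos σ w' (k + j) := by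
      have a1 := hmono.add_le_nat j k
      have a2 := hmono.add_le_nat (p' - j) (k + j)
      rw [show p' - j + (k + j) = k + p' by omega] at a2
      rw [Nat.add_comm j k] at a1
      omega
    rw [e]
    exact hs.apply_blockPos hm _
  have hletter : ∀ j, j + p' < m + 1 →
      blockPos σ w' (k + j + p') = blockPos σ w' (k + j) + p → w' (k + j) = w' (k + j + p') := by
    intro j hj he
    rw [← hs.apply_blockPos_add_one hm, ← hs.apply_blockPos_add_one hm (k + j + p'), he]
    have a1 := hmono.monotone (show k + j + p' ≤ k + m by omega)
    have a2 := hmono.monotone (show k ≤ k + j by omega)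
    obtain ⟨t, ht⟩ := Nat.exists_eq_add_of_le a2
    rw [show blockPos σ w' (k + j) = i + t by omega, show i + t + p + 1 = i + (t + 1) + p by omega]
    exact h (t + 1) (by omega)
  -- Induction: starts of blocks that differ by `p` carry equal letters, hence blocks of equal
  -- length, so the next starts differ by `p` too.
  have hshift : ∀ j, j + p' ≤ m + 1 →
      blockPos σ w' (k + j + p') = blockPos σ w' (k + j) + p := by
    intro j
    induction j with
    | zero =>
      intro _
      rw [Nat.add_zero, ← hk, ← hl]
    | succ j ih =>
      intro hj
      have e1 := ih (by omega)
      have e2 := hletter j (by omega) e1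
      rw [← Nat.add_assoc k j 1, show k + j + 1 + p' = k + j + p' + 1 by omega, blockPos_succ,
        blockPos_succ, e1, e2]
      omega
  refine ⟨k, m + 1, p', by omega, hpp, by omega, fun j hj => hletter j hj (hshift j (by omega)), ?_, ?_⟩
  · have e1 := hm.weight_eq α (k := k) (m := m + 1) (i := i)
      (L := blockPos σ w' (k + (m + 1)) - i) hk
        (by have := hmono.monotone (show k ≤ k + (m + 1) by omega); omega)
    rw [← e1]
    have e2 := weight_mono α w i (k := L) (l := blockPos σ w' (k + (m + 1)) - i + 1)
      (by rw [← Nat.add_assoc k m 1]; omega)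
    rw [weight_add, weight_one] at e2
    have e3 : w (i + (blockPos σ w' (k + (m + 1)) - i)) = x := by
      rw [Nat.add_sub_cancel' (by have := hmono.monotone (show k ≤ k + (m + 1) by omega); omega)]
      exact hs.apply_blockPos hm _
    rwa [e3] at e2
  · exact hm.weight_eq α hk hl

end HasPeriodOn

end Periods

/-! ### No (n + 4)-th powers -/

section PowerBound

variable {A : Type*} [DecidableEq A] {a b c : A} {n : ℕ} {s : ℕ → A}

/-- The word `s` followed by the words `level s 1`, `level s 2`, ... -/
def tower (s : ℕ → A) : ℕ → ℕ → A
  | 0 => s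
  | j + 1 => level s (j + 1)

/-- The substitution that maps `tower s (j + 1)` to `tower s j`. -/
def towerSubst (τ : Equiv.Perm A) (s : ℕ → A) : ℕ → A → List A
  | 0 => levelSubst τ s 1
  | j + 1 => psi (s (j + 1))

/-- Weights of letters for which the substitutions of the tower preserve the weight of words. -/
def towerWeight (τ : Equiv.Perm A) (s : ℕ → A) : ℕ → A → ℕ
  | 0 => fun _ => 1
  | j + 1 => fun u => ((towerSubst τ s j u).map (towerWeight τ s j)).sum

/-- The weight that a run loses in the first `j` desubstitutions. -/
def towerExcess (τ : Equiv.Perm A) (s : ℕ → A) : ℕ → ℕ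
  | 0 => 0
  | j + 1 => towerExcess τ s j + towerWeight τ s j (s j)

namespace IsFixedPointFor

theorem isSeparating_towerSubst (h : IsFixedPointFor a b c n s) (j : ℕ) :
    IsSeparating (s j) (towerSubst (Equiv.swap b c) s j) := by
  rcases j with _ | j
  · rw [h.apply_zero]; exact h.isSeparating_subst_one
  · exact isSeparating_psi _

theorem maps_tower (h : IsFixedPointFor a b c n s) (j : ℕ) :
    Maps (towerSubst (Equiv.swap b c) s j) (tower s (j + 1)) (tower s j) := by
  rcases j with _ | j
  · exact h.maps_subst 1
  · exact maps_level s (j + 1)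

theorem swap_ne (h : IsFixedPointFor a b c n s) {x : A} (hx : x ≠ a) :
    Equiv.swap b c x ≠ a ∧ Equiv.swap b c x ≠ x := by
  rcases h.cover x with rfl | rfl | rfl
  · exact absurd rfl hx
  · simp [h.hac.symm, h.hbc.symm]
  · simp [h.hab.symm, h.hbc]

/-- Read off from the blocks a, abc, acb, each followed by `a`. -/
theorem neighbours (h : IsFixedPointFor a b c n s) {i : ℕ} (hi : s i ≠ a) : 0 < i ∧
    ((s (i - 1) = a ∧ s (i + 1) = Equiv.swap b c (s i)) ∨
      (s (i - 1) = Equiv.swap b c (s i) ∧ s (i + 1) = a)) := by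
  have hs := h.isSeparating_subst_one
  have hm := h.maps_subst 1
  obtain ⟨k, h1, h2⟩ := exists_blockPos_le hs.ne_nil (level s 1) i
  obtain ⟨j, rfl⟩ := Nat.exists_eq_add_of_le h1
  have hj0 : j ≠ 0 := by
    rintro rfl
    exact hi (hs.apply_blockPos hm k)
  have hnext := hs.apply_blockPos hm (k + 1)
  have hstart := hs.apply_blockPos hm k
  have hblock := hm.getElem_block k
  rw [blockPos_succ] at h2 hnext
  refine ⟨by omega, ?_⟩
  generalize blockPos (levelSubst (Equiv.swap b c) s 1) (level s 1) k = B at *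
  have key : ∀ x y, levelSubst (Equiv.swap b c) s 1 (level s 1 k) = [a, x, y] →
      y = Equiv.swap b c x → x = Equiv.swap b c y →
      (s (B + j - 1) = a ∧ s (B + j + 1) = Equiv.swap b c (s (B + j))) ∨
      (s (B + j - 1) = Equiv.swap b c (s (B + j)) ∧ s (B + j + 1) = a) := by
    intro x y e exy eyx
    simp only [e] at hblock h2 hnext
    simp at h2
    have e1 := hblock 1 (by simp)
    have e2 := hblock 2 (by simp)
    simp at e1 e2
    have hj : j = 1 ∨ j = 2 := by omega
    rcases hj with rfl | rfl
    · exact Or.inl ⟨hstart, by rw [e1, ← exy]; exact e2⟩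
    · exact Or.inr ⟨by rw [e2, ← eyx]; exact e1, hnext⟩
  rcases h.cover (level s 1 k) with e | e | e
  · rw [e, h.subst_a h.one_le] at h2
    simp at h2; omega
  · exact key b c (by rw [e, h.subst_b h.one_le]; rfl) (by simp) (by simp)
  · exact key c b (by rw [e, h.subst_c h.one_le]; rfl) (by simp) (by simp)

theorem tower_pos (h : IsFixedPointFor a b c n s) (j m : ℕ) (hm : tower s j m ≠ s j) : 0 < m := by
  rcases j with _ | j
  · rw [h.apply_zero] at hm
    exact (h.neighbours hm).1
  · exact (level_separated s (j + 1) m hm).1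

/-- The condition for extending runs to the left. At level 0 the right neighbour tells whether a
letter is the first or the second of its pair bc or cb; higher up the left neighbour is always the
separating letter. -/
theorem tower_left (h : IsFixedPointFor a b c n s) (j m m' : ℕ) (h0 : tower s j m ≠ s j)
    (h1 : tower s j m = tower s j m') (h2 : tower s j (m + 1) = tower s j (m' + 1)) :
    tower s j (m - 1) = tower s j (m' - 1) := by
  rcases j with _ | j
  · change s m ≠ s 0 at h0
    change s m = s m' at h1
    change s (m + 1) = s (m' + 1) at h2
    change s (m - 1) = s (m' - 1)
    rw [h.apply_zero] at h0
    have hτ := h.swap_ne h0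
    obtain ⟨-, ⟨e1, e2⟩ | ⟨e1, e2⟩⟩ := h.neighbours h0 <;>
    obtain ⟨-, ⟨e3, e4⟩ | ⟨e3, e4⟩⟩ := h.neighbours (h1 ▸ h0)
    · rw [e1, e3]
    · rw [← h2, e2] at e4; exact absurd e4 hτ.1
    · rw [← h2, e2, ← h1] at e4; exact absurd e4.symm hτ.1
    · rw [e1, e3, h1]
  · have e1 := (level_separated s (j + 1) m h0).2.1
    have e2 := (level_separated s (j + 1) m' (by
      change level s (j + 1) m = level s (j + 1) m' at h1
      rw [← h1]; exact h0)).2.1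
    change level s (j + 1) (m - 1) = level s (j + 1) (m' - 1)
    rw [e1, e2]

theorem eq_of_square (h : IsFixedPointFor a b c n s) {j i : ℕ}
    (he : tower s j i = tower s j (i + 1)) : tower s j i = s j := by
  by_contra hne
  rcases j with _ | j
  · change s i = s (i + 1) at he
    change s i ≠ s 0 at hne
    rw [h.apply_zero] at hne
    obtain ⟨-, ⟨-, e⟩ | ⟨-, e⟩⟩ := h.neighbours hne
    · exact (h.swap_ne hne).2 (by rw [← e, he])
    · exact hne (by rw [he, e])
  · have := (level_separated s (j + 1) i hne).2.2
    exact hne (he.trans this)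

/-- A run of a letter in the tower comes from a run of that letter in the directive word. -/
theorem run_directive (h : IsFixedPointFor a b c n s) {y : A} (L : ℕ) :
    ∀ j i, (∀ r < L + 1, tower s j (i + r) = y) → ∀ r < L, s (j + r) = y := by
  induction L with
  | zero => intro j i _ r hr; omega
  | succ L ih =>
    intro j i hrun
    have hy : s j = y := by
      rw [← hrun 0 (by omega)]
      refine (h.eq_of_square ?_).symm
      rw [hrun 0 (by omega)]
      exact (hrun 1 (by omega)).symm
    have hs := h.isSeparating_towerSubst j
    have hm := h.maps_tower j
    obtain ⟨k, hk⟩ := hs.exists_blockPos hm (i := i) (by rw [hy]; exact hrun 0 (by omega))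
    have hone : towerSubst (Equiv.swap b c) s j y = [y] := by
      obtain ⟨r, hr, hx, hhd⟩ := hs y
      rcases r with _ | ⟨z, r⟩
      · rw [hr, hy]
      · simp at hhd hx
        exact absurd (hy.trans hhd.symm) hx.1
    have hup : ∀ r < L + 1, blockPos (towerSubst (Equiv.swap b c) s j) (tower s (j + 1)) (k + r)
        = i + r ∧ tower s (j + 1) (k + r) = y := by
      intro r
      induction r with
      | zero =>
        intro _
        refine ⟨by simpa using hk.symm, ?_⟩
        rw [← hs.apply_blockPos_add_one hm, Nat.add_zero k, ← hk]
        exact hrun 1 (by omega)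
      | succ r ihr =>
        intro hr
        obtain ⟨e1, e2⟩ := ihr (by omega)
        have e3 : blockPos (towerSubst (Equiv.swap b c) s j) (tower s (j + 1)) (k + (r + 1))
            = i + (r + 1) := by
          rw [← Nat.add_assoc k, blockPos_succ, e1, e2, hone]
          simp; omega
        refine ⟨e3, ?_⟩
        rw [← hs.apply_blockPos_add_one hm, e3]
        exact hrun (r + 1 + 1) (by omega)
    intro r hr
    rcases r with _ | r
    · exact hy
    · rw [show j + (r + 1) = j + 1 + r by omega]
      exact ih (j + 1) k (fun r hr => (hup r hr).2) r (by omega)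

/-- A run of n + 2 letters in `s` would force n + 1 equal directive letters at the start of `s`,
against s_0 = a and s_n = b. -/
theorem not_run (h : IsFixedPointFor a b c n s) {y : A} {j L : ℕ} (hL : n + 2 ≤ L)
    (hrun : ∀ r < L, s (j + r) = y) : False := by
  have := h.run_directive (n + 1) 0 j (y := y) (fun r hr => hrun r (by omega))
  have e1 := this 0 (by omega)
  have e2 := this n (by omega)
  rw [Nat.zero_add] at e1 e2
  exact h.hab (by rw [← h.apply_zero, ← h.apply_eq, e1, e2])

theorem towerWeight_self (h : IsFixedPointFor a b c n s) (j : ℕ) :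
    towerWeight (Equiv.swap b c) s (j + 1) (s j) = towerWeight (Equiv.swap b c) s j (s j) := by
  obtain ⟨r, hr, hx, hhd⟩ := h.isSeparating_towerSubst j (s j)
  rcases r with _ | ⟨z, r⟩
  · simp [towerWeight, hr]
  · simp at hhd hx
    exact absurd hhd.symm hx.1

theorem le_towerWeight (h : IsFixedPointFor a b c n s) (j : ℕ) {u : A} (hu : u ≠ s j) :
    towerWeight (Equiv.swap b c) s j (s j) + towerWeight (Equiv.swap b c) s j u ≤
      towerWeight (Equiv.swap b c) s (j + 1) u := by
  obtain ⟨r, hr, hx, hhd⟩ := h.isSeparating_towerSubst j u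
  rcases r with _ | ⟨z, r⟩
  · simp at hhd; exact absurd hhd.symm hu
  · simp at hhd
    subst hhd
    simp [towerWeight, hr]

/-- One of two distinct letters differs from `s j`; going up one level its weight grows by at least
the amount added to the excess. -/
theorem excess_lt_add (h : IsFixedPointFor a b c n s) (j : ℕ) {x y : A} (hxy : x ≠ y) :
    towerExcess (Equiv.swap b c) s j <
      towerWeight (Equiv.swap b c) s j x + towerWeight (Equiv.swap b c) s j y := by
  induction j generalizing x y with
  | zero => simp [towerExcess, towerWeight]
  | succ j ih =>
    have key : ∀ {x y}, x ≠ y → y ≠ s j → towerExcess (Equiv.swap b c) s (j + 1) <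
        towerWeight (Equiv.swap b c) s (j + 1) x + towerWeight (Equiv.swap b c) s (j + 1) y := by
      intro x y hxy hy
      have h1 := h.le_towerWeight j hy
      have h2 := ih hxy
      have h3 : towerWeight (Equiv.swap b c) s j x ≤ towerWeight (Equiv.swap b c) s (j + 1) x := by
        by_cases hx : x = s j
        · rw [hx, h.towerWeight_self]
        · have := h.le_towerWeight j hx; omega
      simp only [towerExcess]
      omega
    by_cases hy : y = s j
    · rw [Nat.add_comm (towerWeight _ _ _ x)]
      exact key hxy.symm (hy ▸ hxy)
    · exact key hxy hy

/-- `e` counts directive letters `y` immediately before `j`. Each of them keeps the weight of `y`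
and adds it once to the excess; before them, the excess is less than twice that weight by
`excess_lt_add`. -/
theorem excess_lt_mul (h : IsFixedPointFor a b c n s) (j : ℕ) (y : A) :
    ∃ e ≤ j, (∀ r < e, s (j - e + r) = y) ∧
      towerExcess (Equiv.swap b c) s j < (e + 2) * towerWeight (Equiv.swap b c) s j y := by
  induction j with
  | zero => exact ⟨0, le_rfl, by simp, by simp [towerExcess, towerWeight]⟩
  | succ j ih =>
    obtain ⟨e, h1, h2, h3⟩ := ih
    by_cases hy : y = s j
    · subst hy
      refine ⟨e + 1, by omega, ?_, ?_⟩
      · intro r hr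
        rw [show j + 1 - (e + 1) = j - e by omega]
        rcases Nat.lt_or_ge r e with hre | hre
        · exact h2 r hre
        · congr 1; omega
      · rw [h.towerWeight_self]
        simp only [towerExcess]
        linarith
    · refine ⟨0, by omega, by simp, ?_⟩
      have h4 := h.le_towerWeight j hy
      have h5 := h.excess_lt_add j (Ne.symm hy)
      simp only [towerExcess]
      omega

/-- The excess on the left makes the induction on `p` close: a desubstitution loses at most the
weight by which the excess grows. At level 0 weight is length and the excess is zero. -/
theorem weight_run_lt (h : IsFixedPointFor a b c n s) (p : ℕ) : ∀ j i L, 1 ≤ p → p ≤ L →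
    HasPeriodOn (tower s j) i L p →
    weight (towerWeight (Equiv.swap b c) s j) (tower s j) i L + towerExcess (Equiv.swap b c) s j <
      (n + 4) * weight (towerWeight (Equiv.swap b c) s j) (tower s j) i p := by
  induction p using Nat.strong_induction_on with
  | _ p ih =>
  intro j i L hp hpL hper
  set α := towerWeight (Equiv.swap b c) s j with hα
  by_cases hconst : ∀ r < p, tower s j (i + r) = tower s j i
  · have hrun := hper.const hp hconst
    rw [weight_const hrun, weight_const hconst]
    obtain ⟨e, he, h1, h2⟩ := h.excess_lt_mul j (tower s j i)
    have hdir := h.run_directive (L - 1) j i (y := tower s j i) (fun r hr => hrun r (by omega))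
    -- The `e` letters before `j` and the L - 1 letters from `j` on form one run of the directive
    -- word `s`.
    have hle : e + (L - 1) < n + 2 := by
      by_contra hge
      refine h.not_run (y := tower s j i) (j := j - e) (L := e + (L - 1)) (by omega) ?_
      intro r hr
      rcases Nat.lt_or_ge r e with hre | hre
      · exact h1 r hre
      · have := hdir (r - e) (by omega)
        rw [← this]; congr 1; omega
    rw [← hα] at h2
    calc L * α (tower s j i) + towerExcess (Equiv.swap b c) s j
        < L * α (tower s j i) + (e + 2) * α (tower s j i) := by omega
      _ = (L + e + 2) * α (tower s j i) := by ring
      _ ≤ (n + 4) * α (tower s j i) := Nat.mul_le_mul_right _ (by omega)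
      _ ≤ (n + 4) * (p * α (tower s j i)) :=
          Nat.mul_le_mul_left _ (Nat.le_mul_of_pos_left _ (by omega))
  · push Not at hconst
    obtain ⟨r, hr, hne⟩ := hconst
    have hr0 : 0 < r := Nat.pos_of_ne_zero (by rintro rfl; exact hne rfl)
    have hβ : towerExcess (Equiv.swap b c) s j < weight α _ i p :=
      (h.excess_lt_add j hne.symm).trans_le (add_le_weight α (tower s j) (i := i) hr0 hr)
    -- A nonconstant period has p ≥ 2, so a run longer than 2p satisfies the bound p + 2 ≤ L needed
    -- to desubstitute. For a shorter run two periods bound its weight and a third absorbs the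
    -- excess.
    rcases Nat.lt_or_ge (2 * p) L with hL | hL
    · obtain ⟨i₀, M, e1, e2, e3, e4, e5⟩ := HasPeriodOn.exists_extension (x := s j)
        (h.tower_pos j) (h.tower_left j) hp α i L (by omega) hper
      obtain ⟨k, L', p', f1, f2, f3, f4, f5, f6⟩ := e4.exists_desubst
        (h.isSeparating_towerSubst j) (h.maps_tower j) hp (by omega) e1 (by
          by_contra hall
          push Not at hall
          have hall' := e4.const hp hall
          apply hne
          have g1 := hall' (i + r - i₀) (by omega)
          have g2 := hall' (i - i₀) (by omega)
          rw [show i₀ + (i + r - i₀) = i + r by omega] at g1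
          rw [show i₀ + (i - i₀) = i by omega] at g2
          rw [g1, g2]) α
      have g := ih p' f2 (j + 1) k L' f1 f3 f4
      change weight (fun u => ((towerSubst (Equiv.swap b c) s j u).map α).sum) _ k L' +
        (towerExcess (Equiv.swap b c) s j + α (s j)) < (n + 4) *
        weight (fun u => ((towerSubst (Equiv.swap b c) s j u).map α).sum) _ k p' at g
      rw [← f6, e5] at g
      have g2 : weight α (tower s j) i L ≤ weight α (tower s j) i₀ M := by
        rw [show M = (i - i₀) + L by omega, weight_add, show i₀ + (i - i₀) = i by omega]
        omega
      omega
    · have := hper.weight_le_two_mul α hpL hL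
      nlinarith [Nat.zero_le (n * weight α (tower s j) i p)]

theorem not_hasPeriodOn (h : IsFixedPointFor a b c n s) {p i : ℕ} (hp : 1 ≤ p) :
    ¬ HasPeriodOn s i ((n + 4) * p) p := by
  intro hper
  have := h.weight_run_lt p 0 i ((n + 4) * p) hp (Nat.le_mul_of_pos_left _ (by omega)) hper
  simp [weight, towerWeight, tower, towerExcess] at this

end IsFixedPointFor

theorem hasPeriodOn_of_flatten {u : List A} {m i : ℕ} {w : ℕ → A}
    (h : factorAt w i (List.replicate m u).flatten.length = (List.replicate m u).flatten) :
    HasPeriodOn w i (m * u.length) u.length := by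
  rw [factorAt_eq_iff] at h
  intro j hj
  rcases m with _ | m
  · omega
  have hlen : ∀ m, (List.replicate m u).flatten.length = m * u.length := by simp
  have h1 := h j (by rw [hlen]; omega)
  have h2 := h (j + u.length) (by rw [hlen]; omega)
  rw [← Nat.add_assoc] at h2
  rw [← h1, ← h2]
  have e1 : (List.replicate (m + 1) u).flatten = u ++ (List.replicate m u).flatten := by
    simp [List.replicate_succ]
  have e2 : (List.replicate (m + 1) u).flatten = (List.replicate m u).flatten ++ u := by
    simp [List.replicate_succ']
  have hjm : j < (List.replicate m u).flatten.length := by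
    rw [hlen]; rw [Nat.succ_mul] at hj; omega
  have f1 := List.getElem_of_eq e2 (i := j) (by rw [hlen]; omega)
  have f2 := List.getElem_of_eq e1 (i := j + u.length) (by rw [hlen]; omega)
  rw [f1, f2, List.getElem_append_left hjm, List.getElem_append_right (by omega)]
  simp

theorem IsFixedPointFor.not_containsPower (h : IsFixedPointFor a b c n s) :
    ¬ ContainsPower s (n + 4) := by
  rintro ⟨u, hu, i, hi⟩
  exact h.not_hasPeriodOn (List.length_pos_iff.2 hu) (hasPeriodOn_of_flatten hi)

end PowerBound

/-! ### An (n + 3)-rd power -/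

section PowerExistence

variable {A : Type*} [DecidableEq A] {a b c : A} {n : ℕ} {s : ℕ → A}

/-- Going down through a directive letter `y` lengthens a run of `y` by one, since the block after
the run also starts with `y`. -/
theorem level_run (s : ℕ → A) {y : A} (m : ℕ) : ∀ j k L, (∀ r < m, s (j + r) = y) →
    (∀ r < L, level s (j + m) (k + r) = y) →
    ∃ k', k ≤ k' ∧ ∀ r < L + m, level s j (k' + r) = y := by
  induction m with
  | zero => intro j k L _ h; exact ⟨k, le_rfl, h⟩
  | succ m ih =>
    intro j k L hdir hrun
    obtain ⟨k₁, h1, h2⟩ := ih (j + 1) k L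
      (fun r hr => by rw [show j + 1 + r = j + (r + 1) by omega]; exact hdir _ (by omega))
      (fun r hr => by rw [show j + 1 + m = j + (m + 1) by omega]; exact hrun r hr)
    have hs := isSeparating_psi (s j)
    have hm := maps_level s j
    have hy : s j = y := hdir 0 (by omega)
    have hpos : ∀ r ≤ L + m, blockPos (psi (s j)) (level s (j + 1)) (k₁ + r) =
        blockPos (psi (s j)) (level s (j + 1)) k₁ + r := by
      intro r
      induction r with
      | zero => intro _; rfl
      | succ r ihr =>
        intro hr
        rw [← Nat.add_assoc k₁, blockPos_succ, ihr (by omega), h2 r (by omega), hy, psi_self]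
        simp; omega
    refine ⟨blockPos (psi (s j)) (level s (j + 1)) k₁,
      h1.trans ((blockPos_strictMono hs.ne_nil _).id_le k₁), fun r hr => ?_⟩
    rw [← hpos r (by omega), hs.apply_blockPos hm, hy]

theorem levelSubst_one_succ (s : ℕ → A) (p : ℕ) (u : A) :
    levelSubst 1 s (p + 1) u =
      (levelSubst 1 (fun i => s (i + 1)) p u).flatMap (psi (s 0)) := by
  induction p generalizing u with
  | zero =>
    have : mu (1 : Equiv.Perm A) = fun u => [u] := by funext u; simp [mu]
    simp [levelSubst, this]
  | succ p ih =>
    change (psi (s (p + 1)) u).flatMap (levelSubst 1 s (p + 1)) = _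
    rw [funext ih, ← List.flatMap_assoc]
    rfl

theorem levelSubst_eq_flatMap_mu (τ : Equiv.Perm A) (s : ℕ → A) (p : ℕ) (u : A) :
    levelSubst τ s p u = (levelSubst 1 s p u).flatMap (mu τ) := by
  induction p generalizing u with
  | zero => simp [levelSubst, mu]
  | succ p ih =>
    change (psi (s p) u).flatMap (levelSubst τ s p) = _
    rw [funext ih, ← List.flatMap_assoc]
    rfl

theorem epal_prefixOf_succ (s : ℕ → A) (j : ℕ) :
    epal (prefixOf s (j + 1)) = levelSubst 1 s j (s j) ++ epal (prefixOf s j) := by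
  induction j generalizing s with
  | zero => simp [prefixOf, factorAt, epal, levelSubst, mu]
  | succ j ih =>
    have e : ∀ k, prefixOf s (k + 1) = s 0 :: prefixOf (fun i => s (i + 1)) k := fun k => by
      simp [prefixOf, factorAt, List.range_succ_eq_map, Function.comp_def]
    rw [e, e, epal, epal, ih, levelSubst_one_succ]
    simp

/-- Every image under `levelSubst` is followed by the same word, up to the cut at the end. -/
theorem epal_prefix_flatMap_levelSubst (τ : Equiv.Perm A) (s : ℕ → A) (j : ℕ) (l : List A) :
    (epal (prefixOf s j)).flatMap (mu τ) <+:
      l.flatMap (levelSubst τ s j) ++ (epal (prefixOf s j)).flatMap (mu τ) := by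
  induction j generalizing l with
  | zero => simp [prefixOf, factorAt, epal]
  | succ j ih =>
    obtain ⟨E, hE⟩ := exists_flatMap_psi_concat (s j) l
    have e1 : (epal (prefixOf s (j + 1))).flatMap (mu τ) =
        levelSubst τ s j (s j) ++ (epal (prefixOf s j)).flatMap (mu τ) := by
      rw [epal_prefixOf_succ, List.flatMap_append, ← levelSubst_eq_flatMap_mu]
    have e2 : l.flatMap (levelSubst τ s (j + 1)) ++ levelSubst τ s j (s j) =
        levelSubst τ s j (s j) ++ E.flatMap (levelSubst τ s j) := by
      have := congrArg (List.flatMap (levelSubst τ s j)) hE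
      rw [List.flatMap_append, List.flatMap_assoc] at this
      simpa [levelSubst] using this
    rw [e1, ← List.append_assoc, e2, List.append_assoc, List.prefix_append_right_inj]
    exact ih E

/-- If the directive letter has occurred before, the next palindromic prefix is at most twice as
long, so the block put in front of the old one is no longer than it and is a prefix of it. -/
theorem levelSubst_prefix_epal (τ : Equiv.Perm A) {s : ℕ → A} {j : ℕ}
    (h : s j ∈ prefixOf s j) : levelSubst τ s j (s j) <+: (epal (prefixOf s j)).flatMap (mu τ) := by
  rw [levelSubst_eq_flatMap_mu]
  apply flatMap_prefix
  obtain ⟨v₁, v₂, h1, h2⟩ := exists_last_split h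
  obtain ⟨D, h3, h4⟩ := epal_concat_of_split v₁ v₂ h2
  rw [← h1, ← prefixOf_succ, epal_prefixOf_succ] at h4
  rw [← h1] at h3
  have hlen : (levelSubst 1 s j (s j)).length ≤ (epal (prefixOf s j)).length := by
    have e1 := congrArg List.length h3
    have e2 := congrArg List.length h4
    simp only [List.length_append] at e1 e2
    omega
  exact List.prefix_of_prefix_length_le (List.prefix_append _ _) ⟨D, h4.symm⟩ hlen

namespace IsFixedPointFor

/-- An `a` in level `n`, which starts with `b`, grows by one under each of the first `n` directive
letters `a`, and mu fixes `a`. That `j` is positive ensures that `a` is an earlier directive letter.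
-/
theorem exists_run (h : IsFixedPointFor a b c n s) : ∃ j, 1 ≤ j ∧ ∀ r < n + 1, s (j + r) = a := by
  obtain ⟨k, hk⟩ := h.exists_level_eq n a
  have hk0 : k ≠ 0 := by
    rintro rfl
    rw [level_zero_eq, h.apply_eq] at hk
    exact h.hab hk.symm
  obtain ⟨k', h1, h2⟩ := level_run s n 0 k 1 (y := a)
    (fun r hr => by rw [Nat.zero_add]; exact h.apply_lt hr)
    (fun r hr => by
      obtain rfl : r = 0 := by omega
      rw [Nat.zero_add]; exact hk)
  have hm := h.maps_subst 0
  have ha : levelSubst (Equiv.swap b c) s 0 a = [a] := h.subst_a (Nat.zero_le n)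
  have hpos : ∀ r ≤ n + 1, blockPos (levelSubst (Equiv.swap b c) s 0) (level s 0) (k' + r) =
      blockPos (levelSubst (Equiv.swap b c) s 0) (level s 0) k' + r := by
    intro r
    induction r with
    | zero => intro _; rfl
    | succ r ihr =>
      intro hr
      rw [← Nat.add_assoc k', blockPos_succ, ihr (by omega), h2 r (by omega), ha]
      simp; omega
  refine ⟨blockPos (levelSubst (Equiv.swap b c) s 0) (level s 0) k', ?_, fun r hr => ?_⟩
  · have := (blockPos_strictMono (levelSubst_ne_nil (Equiv.swap b c) s 0) (level s 0)).id_le k'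
    simp only [id] at this
    omega
  · rw [← hpos r (by omega)]
    have := hm.getElem_block (k' + r) 0 (by rw [h2 r (by omega), ha]; simp)
    simpa [h2 r (by omega), ha] using this

theorem containsPower (h : IsFixedPointFor a b c n s) : ContainsPower s (n + 3) := by
  obtain ⟨j, hj, hrun⟩ := h.exists_run
  have hsj : s j = a := hrun 0 (by omega)
  obtain ⟨k₁, hk₁⟩ := h.exists_level_eq (j + (n + 1)) a
  obtain ⟨k, -, hk⟩ := level_run s (n + 1) j k₁ 1 hrun (fun r hr => by
    obtain rfl : r = 0 := by omega
    exact hk₁)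
  set σ := levelSubst (Equiv.swap b c) s j with hσ
  have hm : Maps σ (level s j) s := h.maps_subst j
  have hne : ∀ u, σ u ≠ [] := levelSubst_ne_nil _ s j
  refine ⟨σ a, hne a, blockPos σ (level s j) k, ?_⟩
  -- The n + 2 letters `a` give σ(a)^{n+2}. As blocks are nonempty, the next |σ(a)| blocks leave
  -- room for one more σ(a), which every continuation begins with.
  have h1 := hm.factorAt_blockPos k (n + 2 + (σ a).length)
  apply factorAt_of_prefix h1
  have h2 : factorAt (level s j) k (n + 2) = List.replicate (n + 2) a := by
    apply List.ext_getElem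
    · simp
    · intro r hr _
      simp at hr
      simpa using hk r (by omega)
  rw [factorAt_add, h2, List.flatMap_append, flatMap_replicate,
    show n + 3 = n + 2 + 1 from rfl, List.replicate_succ', List.flatten_append,
    List.prefix_append_right_inj]
  have h3 := levelSubst_prefix_epal (Equiv.swap b c) (s := s) (j := j)
    (mem_prefixOf.2 ⟨0, hj, by rw [h.apply_zero, hsj]⟩)
  rw [hsj] at h3
  have h4 := h3.trans (epal_prefix_flatMap_levelSubst (Equiv.swap b c) s j
    (factorAt (level s j) (k + (n + 2)) (σ a).length))
  have h5 := List.prefix_of_prefix_length_le h4 (List.prefix_append _ _) (by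
    have := flatMap_length_ge hne (factorAt (level s j) (k + (n + 2)) (σ a).length)
    simpa using this)
  simpa using h5

end IsFixedPointFor

end PowerExistence

/-! ### Cancelling ψ_x on finite words -/

section PsiLists

variable {A : Type*} [DecidableEq A] {x e : A}

theorem exists_eq_flatMap_psi_of_prefix (he : e ≠ x) (c : List A) :
    ∀ H, H ++ [e] <+: c.flatMap (psi x) → ∃ H' : List A, H = H'.flatMap (psi x) ++ [x] := by
  induction c with
  | nil => intro H h; simp at h
  | cons u c ih =>
    intro H h
    by_cases hu : u = x
    · subst hu
      simp only [List.flatMap_cons, psi_self, List.singleton_append] at h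
      rcases H with _ | ⟨y, H⟩
      · simp at h; exact absurd h he
      · simp only [List.cons_append, List.cons_prefix_cons] at h
        obtain ⟨rfl, h⟩ := h
        obtain ⟨H', rfl⟩ := ih H h
        exact ⟨y :: H', by simp⟩
    · simp only [List.flatMap_cons, psi_of_ne hu, List.cons_append, List.nil_append] at h
      rcases H with _ | ⟨y, H⟩
      · simp at h; exact absurd h he
      · simp only [List.cons_append, List.cons_prefix_cons] at h
        obtain ⟨rfl, h⟩ := h
        rcases H with _ | ⟨z, H⟩
        · exact ⟨[], by simp⟩
        · simp only [List.cons_append, List.cons_prefix_cons] at h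
          obtain ⟨rfl, h⟩ := h
          obtain ⟨H', rfl⟩ := ih H h
          exact ⟨z :: H', by simp [psi_of_ne hu]⟩

/-- The pair `xe` decodes to `e` also when e = x, because the next block then starts with `x`. -/
theorem prefix_of_flatMap_psi_prefix (H : List A) :
    ∀ c, H.flatMap (psi x) ++ [x, e] <+: c.flatMap (psi x) → H ++ [e] <+: c := by
  have hhead : ∀ (y : A) (t c : List A), y :: t <+: c.flatMap (psi x) → y = x := by
    intro y t c h
    rcases c with _ | ⟨v, c⟩
    · simp at h
    · by_cases hv : v = x
      · simp [hv] at h; exact h.1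
      · simp [psi_of_ne hv] at h; exact h.1
  induction H with
  | nil =>
    intro c h
    rcases c with _ | ⟨v, c⟩
    · simp at h
    · by_cases hv : v = x
      · subst hv
        simp only [List.flatMap_nil, List.nil_append, List.flatMap_cons, psi_self,
          List.cons_append, List.cons_prefix_cons, true_and] at h
        simp [hhead _ _ _ h]
      · simp [psi_of_ne hv] at h
        simp [h]
  | cons u H ih =>
    intro c h
    rcases c with _ | ⟨v, c⟩
    · by_cases hu : u = x
      · simp [hu] at h
      · simp [psi_of_ne hu] at h
    · have huv : u = v := by
        by_cases hu : u = x <;> by_cases hv : v = x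
        · rw [hu, hv]
        · subst hu
          simp only [List.flatMap_cons, psi_self, psi_of_ne hv, List.cons_append,
            List.nil_append, List.cons_prefix_cons, true_and] at h
          rcases H with _ | ⟨w, H⟩
          · simp at h; exact h.1
          · by_cases hw : w = u
            · simp [hw] at h; exact h.1
            · simp [psi_of_ne hw] at h; exact h.1
        · subst hv
          simp only [List.flatMap_cons, psi_self, psi_of_ne hu, List.cons_append,
            List.nil_append, List.cons_prefix_cons, true_and] at h
          exact hhead _ _ _ h
        · simp only [List.flatMap_cons, psi_of_ne hv, psi_of_ne hu, List.cons_append,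
            List.nil_append, List.cons_prefix_cons, true_and] at h
          exact h.1
      subst huv
      rw [List.flatMap_cons, List.flatMap_cons, List.append_assoc,
        List.prefix_append_right_inj] at h
      simpa using ih c h

theorem head_eq_of_flatMap_psi_eq_cons {y : A} {t c : List A} (h : c.flatMap (psi x) = y :: t) :
    y = x := by
  rcases c with _ | ⟨v, c⟩
  · simp at h
  · by_cases hv : v = x
    · simp [hv] at h; exact h.1.symm
    · simp [psi_of_ne hv] at h; exact h.1.symm

/-- The final `x` of the common prefix is decoded together with what follows. If e = x the exponent
increases by one; if e ≠ x it must be 1, since ee cannot occur in a ψ_x-image. -/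
theorem flatMap_psi_eq_pure {H c : List A} {i : ℕ} (hi : i = 0 → e = x)
    (h : c.flatMap (psi x) = H.flatMap (psi x) ++ [x] ++ List.replicate i e) :
    ∃ j, 1 ≤ j ∧ c = H ++ List.replicate j e := by
  have hinj := (isSeparating_psi x).flatMap_injective
  by_cases he : e = x
  · subst he
    refine ⟨i + 1, by omega, hinj ?_⟩
    simp [h, List.replicate_succ, flatMap_replicate]
  · obtain ⟨i, rfl⟩ : ∃ k, i = k + 1 := Nat.exists_eq_succ_of_ne_zero (fun h => he (hi h))
    obtain ⟨t, rfl⟩ := prefix_of_flatMap_psi_prefix (e := e) H c (by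
      rw [h, List.replicate_succ]; simp)
    refine ⟨1, le_rfl, ?_⟩
    rcases i with _ | i
    · simp [psi_of_ne he] at h
      rcases t with _ | ⟨v, t⟩
      · simp
      · exact absurd (h v (by simp)) (psi_ne_nil x v)
    · simp only [List.flatMap_append, List.flatMap_cons, psi_of_ne he, List.replicate_succ,
        List.append_assoc, List.append_cancel_left_eq, List.cons_append, List.nil_append,
        List.cons.injEq, true_and] at h
      exact absurd (head_eq_of_flatMap_psi_eq_cons h) he

theorem length_lt_flatMap_psi {c : List A} (he : e ≠ x) (h : e ∈ c.flatMap (psi x)) :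
    c.length < (c.flatMap (psi x)).length := by
  induction c with
  | nil => simp at h
  | cons v c ih =>
    have hge := flatMap_length_ge (psi_ne_nil x) c
    by_cases hv : v = x
    · subst hv
      simp only [List.flatMap_cons, psi_self, List.singleton_append, List.mem_cons] at h
      have := ih (h.resolve_left he)
      rw [List.flatMap_cons, psi_self, List.length_append]
      simp only [List.length_cons, List.length_nil]
      omega
    · rw [List.flatMap_cons, psi_of_ne hv, List.length_append]
      simp only [List.length_cons, List.length_nil]
      omega

end PsiLists

/-! ### Simplifying an intertwining substitution -/

section Morphisms

variable {A : Type*} [DecidableEq A] {a b c : A} {n : ℕ} {s : ℕ → A}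

/-- `F` maps the blocks of `s` at level `p` to products of blocks at level `q`, as given by `χ`. -/
structure Intertwines (τ : Equiv.Perm A) (s : ℕ → A) (F : A → List A) (p q : ℕ)
    (χ : A → List A) : Prop where
  comm : ∀ u, (levelSubst τ s p u).flatMap F = (χ u).flatMap (levelSubst τ s q)
  maps : Maps χ (level s p) (level s q)

/-- All words `χ u` start with `H (f u)`, where `f` is not constant, and `χ u` is `H` followed by
a power of `f u` if `u ∈ U`. -/
structure IntertwinesWith (τ : Equiv.Perm A) (s : ℕ → A) (F : A → List A) (p q : ℕ)
    (χ : A → List A) (H : List A) (f : A → A) (U : Set A) : Prop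
    extends Intertwines τ s F p q χ where
  pre : ∀ u, H ++ [f u] <+: χ u
  nonconst : ∃ u v, f u ≠ f v
  pure : ∀ u ∈ U, ∃ i, 1 ≤ i ∧ χ u = H ++ List.replicate i (f u)

namespace IsFixedPointFor

variable {τ : Equiv.Perm A} {F : A → List A} {p q : ℕ} {χ : A → List A} {H : List A} {f : A → A}
  {U : Set A}

theorem exists_peel (h : IsFixedPointFor a b c n s) (hχ : Intertwines τ s F p q χ)
    (hhead : ∀ u, (χ u).head? = some (s q)) :
    ∃ χ', Intertwines τ s F p (q + 1) χ' ∧ ∀ u, χ u = (χ' u).flatMap (psi (s q)) := by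
  obtain ⟨χ', h1, h2⟩ := (isSeparating_psi (s q)).factor hχ.maps (maps_level s q) hhead
    (h.exists_level_eq p)
  refine ⟨χ', ⟨fun u => ?_, h2⟩, h1⟩
  rw [hχ.comm, h1, List.flatMap_assoc]
  rfl

theorem intertwines_succ (hχ : Intertwines τ s F p q χ) :
    Intertwines τ s F (p + 1) q (fun u => (psi (s p) u).flatMap χ) := by
  refine ⟨fun u => ?_, hχ.maps.comp (maps_level s p)⟩
  simp only [levelSubst, List.flatMap_assoc, hχ.comm]

/-- Desubstitution of an intertwining substitution whose values have the prefix `H`. -/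
theorem exists_desubst_prefix (h : IsFixedPointFor a b c n s) (hχ : Intertwines τ s F p q χ)
    (hH : H ≠ []) (hpre : ∀ u, H ++ [f u] <+: χ u ∨ χ u = H ∧ f u = s q)
    (hf : ∃ u v, f u ≠ f v)
    (hU : ∀ u ∈ U, ∃ i, (i = 0 → f u = s q) ∧ χ u = H ++ List.replicate i (f u)) :
    ∃ χ' H', H'.length < H.length ∧ IntertwinesWith τ s F p (q + 1) χ' H' f U := by
  have hpre' : ∀ u, H <+: χ u := fun u => (hpre u).elim
    (fun hu => (List.prefix_append _ _).trans hu) (fun hu => by rw [hu.1])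
  have hhead : ∀ u, (χ u).head? = some (s q) := by
    obtain ⟨e, t, rfl⟩ := List.exists_cons_of_ne_nil hH
    obtain ⟨r, hr⟩ := hpre' (level s p 0)
    have h0 := hχ.maps.head_eq (e := e) (t := t ++ r) (by rw [← hr]; simp)
    rw [level_zero_eq] at h0
    intro u
    obtain ⟨r, hr⟩ := hpre' u
    rw [← hr, h0]
    simp
  obtain ⟨χ', h1, h2⟩ := h.exists_peel hχ hhead
  -- Some image continues `H` by a letter other than the separating one, so `H` must end with the
  -- separating letter; removing that letter makes `H` decodable.
  obtain ⟨u₀, hu₀⟩ : ∃ u, f u ≠ s q := by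
    obtain ⟨u, v, huv⟩ := hf
    by_cases hu : f u = s q
    · exact ⟨v, fun hv => huv (hu.trans hv.symm)⟩
    · exact ⟨u, hu⟩
  obtain ⟨H', rfl⟩ := exists_eq_flatMap_psi_of_prefix hu₀ (χ' u₀) H (by
    rw [← h2]; exact (hpre u₀).resolve_right (fun hu => hu₀ hu.2))
  have hinj := (isSeparating_psi (s q)).flatMap_injective
  refine ⟨χ', H', ?_, h1, fun u => ?_, hf, fun u hu => ?_⟩
  · have := flatMap_length_ge (psi_ne_nil (s q)) H'
    rw [List.length_append, List.length_singleton]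
    omega
  · rcases hpre u with hu | ⟨hu, hfu⟩
    · apply prefix_of_flatMap_psi_prefix (x := s q)
      rw [← h2]
      simpa using hu
    · have : χ' u = H' ++ [f u] := by
        apply hinj
        simp only [← h2, hu, hfu, List.flatMap_append, List.flatMap_cons, psi_self]
        simp
      rw [this]
  · obtain ⟨i, hi, he⟩ := hU u hu
    exact flatMap_psi_eq_pure hi (by rw [← h2, he])

theorem exists_trivial_prefix (h : IsFixedPointFor a b c n s)
    (hχ : IntertwinesWith τ s F p q χ H f U) :
    ∃ q' χ', IntertwinesWith τ s F p q' χ' [] f U := by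
  induction hn : H.length using Nat.strong_induction_on generalizing q χ H with
  | _ m ih =>
  subst hn
  by_cases hH : H = []
  · subst hH; exact ⟨q, χ, hχ⟩
  · obtain ⟨χ', H', h1, h2⟩ := h.exists_desubst_prefix hχ.toIntertwines hH
      (fun u => Or.inl (hχ.pre u)) hχ.nonconst
      (fun u hu => by
        obtain ⟨i, hi, he⟩ := hχ.pure u hu
        exact ⟨i, fun h0 => by omega, he⟩)
    exact ih _ h1 h2 rfl

/-- With z = s_p, composing with ψ_z gives the images χ(z) and χ(z)χ(u), whose common prefix is
χ(z). Once it has been desubstituted away, `z` itself has become a power of f(z), while purity of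
the other letters and `f` are preserved. -/
theorem exists_stage (h : IsFixedPointFor a b c n s)
    (hχ : IntertwinesWith τ s F p q χ [] f U) :
    ∃ q' χ', IntertwinesWith τ s F (p + 1) q' χ' [] f (insert (s p) U) := by
  have hfz : f (s p) = s q := by
    obtain ⟨t, ht⟩ := hχ.pre (s p)
    have := hχ.maps.head_eq (e := f (s p)) (t := t) (by rw [level_zero_eq, ← ht]; simp)
    rw [← this, level_zero_eq]
  have hne : χ (s p) ≠ [] := by
    obtain ⟨t, ht⟩ := hχ.pre (s p)
    rw [← ht]; simp
  obtain ⟨χ', H', -, h2⟩ := h.exists_desubst_prefix (f := f) (U := insert (s p) U)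
    (intertwines_succ hχ.toIntertwines) hne
    (fun u => by
      by_cases hu : u = s p
      · subst hu
        exact Or.inr ⟨by simp, hfz⟩
      · left
        simpa [psi_of_ne hu] using hχ.pre u)
    hχ.nonconst
    (fun u hu => by
      by_cases hus : u = s p
      · subst hus
        exact ⟨0, fun _ => hfz, by simp⟩
      · obtain ⟨i, hi, he⟩ := hχ.pure u (Set.mem_of_mem_insert_of_ne hu hus)
        exact ⟨i, fun h0 => by omega, by simpa [psi_of_ne hus] using he⟩)
  exact h.exists_trivial_prefix h2

/-- A window of the directive word as long as the recurrence gap contains every letter, and each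
stage purifies the directive letter it consumes. -/
theorem exists_pure (h : IsFixedPointFor a b c n s)
    (hχ : IntertwinesWith τ s F p q χ [] f U) :
    ∃ p' q' χ', IntertwinesWith τ s F p' q' χ' [] f Set.univ := by
  have key : ∀ k, ∃ q' χ', IntertwinesWith τ s F (p + k) q' χ' [] f
      {y | ∃ i, p ≤ i ∧ i < p + k ∧ s i = y} := by
    intro k
    induction k with
    | zero =>
      refine ⟨q, χ, hχ.toIntertwines, hχ.pre, hχ.nonconst, ?_⟩
      rintro u ⟨i, h1, h2, -⟩
      omega
    | succ k ih =>
      obtain ⟨q', χ', hk⟩ := ih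
      obtain ⟨q'', χ'', hk'⟩ := h.exists_stage hk
      refine ⟨q'', χ'', hk'.toIntertwines, hk'.pre, hk'.nonconst, ?_⟩
      rintro u ⟨i, h1, h2, rfl⟩
      apply hk'.pure
      by_cases hi : i = p + k
      · subst hi; exact Set.mem_insert _ _
      · exact Set.mem_insert_of_mem _ ⟨i, h1, by omega, rfl⟩
  obtain ⟨G, hG⟩ := h.exists_gap
  obtain ⟨q', χ', hk⟩ := key G
  exact ⟨p + G, q', χ', hk.toIntertwines, hk.pre, hk.nonconst, fun u _ => hk.pure u (hG p u)⟩

/-- While all images share their first letter it can be peeled off. This terminates: a letter other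
than the separating one occurs in level `q`, and the image containing it gets shorter. -/
theorem exists_intertwinesWith (h : IsFixedPointFor a b c n s) (hχ : Intertwines τ s F p q χ)
    (hne : ∀ u, χ u ≠ []) : ∃ q' χ' f, IntertwinesWith τ s F p q' χ' [] f ∅ := by
  induction hn : (χ a).length + (χ b).length + (χ c).length using Nat.strong_induction_on
    generalizing q χ with
  | _ m ih =>
  subst hn
  by_cases hc : ∃ u v, (χ u).head (hne u) ≠ (χ v).head (hne v)
  · refine ⟨q, χ, fun u => (χ u).head (hne u), hχ, fun u => ?_, hc, by simp⟩
    obtain ⟨e, t, he⟩ := List.exists_cons_of_ne_nil (hne u)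
    simp [he]
  · push Not at hc
    have hhead : ∀ u, (χ u).head? = some (s q) := by
      intro u
      rw [List.head?_eq_some_head (hne u), hc u (level s p 0)]
      obtain ⟨e, t, he⟩ := List.exists_cons_of_ne_nil (hne (level s p 0))
      have := hχ.maps.head_eq he
      rw [level_zero_eq] at this
      simp [he, this]
    obtain ⟨χ', h1, h2⟩ := h.exists_peel hχ hhead
    have hle : ∀ u, (χ' u).length ≤ (χ u).length := fun u => by
      rw [h2]; exact flatMap_length_ge (psi_ne_nil _) _
    have hlt : ∃ u, (χ' u).length < (χ u).length := by
      obtain ⟨e, he⟩ : ∃ e, e ≠ s q := by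
        by_cases ha : a = s q
        · exact ⟨b, fun hb => h.hab (ha.trans hb.symm)⟩
        · exact ⟨a, ha⟩
      obtain ⟨k, hk⟩ := h.exists_level_eq q e
      obtain ⟨l, hl1, hl2⟩ := exists_blockPos_le hne (level s p) k
      obtain ⟨j, rfl⟩ := Nat.exists_eq_add_of_le hl1
      rw [blockPos_succ] at hl2
      have := hχ.maps.getElem_block l j (by omega)
      refine ⟨level s p l, ?_⟩
      rw [h2]
      apply length_lt_flatMap_psi he
      rw [← h2, ← hk, this]
      exact List.getElem_mem _
    refine ih _ ?_ h1 (fun u hu => hne u (by rw [h2, hu]; rfl)) rfl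
    obtain ⟨u, hu⟩ := hlt
    have ha := hle a
    have hb := hle b
    have hc := hle c
    rcases h.cover u with rfl | rfl | rfl <;> omega

end IsFixedPointFor

end Morphisms

/-! ### Only the identity fixes the word -/

section FixedByMorphism

variable {A : Type*} [DecidableEq A] {a b c : A} {n : ℕ} {s : ℕ → A}

namespace IsFixedPointFor

variable {τ : Equiv.Perm A} {F : A → List A} {p q : ℕ} {χ : A → List A} {f : A → A}

theorem finite (h : IsFixedPointFor a b c n s) : Finite A := by
  apply Finite.of_surjective (fun i : Fin 3 => ![a, b, c] i)
  intro x
  rcases h.cover x with rfl | rfl | rfl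
  · exact ⟨0, rfl⟩
  · exact ⟨1, rfl⟩
  · exact ⟨2, rfl⟩

/-- A letter other than the separating one has no square. -/
theorem exponent_eq_one (h : IsFixedPointFor a b c n s) (hχ : Maps χ (level s p) (level s q))
    {u e : A} {i : ℕ} (hi : 1 ≤ i) (hu : χ u = List.replicate i e) (he : e ≠ s q) : i = 1 := by
  by_contra hne
  obtain ⟨k, rfl⟩ := h.exists_level_eq p u
  have h1 := hχ.getElem_block k 0 (by rw [hu]; simp; omega)
  have h2 := hχ.getElem_block k 1 (by rw [hu]; simp; omega)
  simp only [hu, List.getElem_replicate, Nat.add_zero] at h1 h2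
  have := (level_separated s q (blockPos χ (level s p) k) (by rw [h1]; exact he)).2.2
  rw [h2] at this
  exact he this

/-- One directive letter at `p` corresponds to `i` directive letters f(s_p) from `q` on. After
composing with ψ_{s_p}, each of `i` peelings removes one copy of f(s_p) in front of the images of
the other letters and leaves the image of `s p` unchanged. -/
theorem maps_power (h : IsFixedPointFor a b c n s) {i : ℕ} (hi : 1 ≤ i)
    (hχ : Maps χ (level s p) (level s q)) (hz : χ (s p) = List.replicate i (f (s p)))
    (hne : ∀ u ≠ s p, χ u = [f u]) (hf : Function.Injective f) :
    Maps χ (level s (p + 1)) (level s (q + i)) := by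
  have hx : f (s p) = s q := by
    obtain ⟨i, rfl⟩ := Nat.exists_eq_add_of_le' hi
    have := hχ.head_eq (e := f (s p)) (t := List.replicate i (f (s p)))
      (by rw [level_zero_eq, hz, List.replicate_succ])
    rw [← this, level_zero_eq]
  have key : ∀ r ≤ i, Maps (fun u => if u = s p then χ u else
      List.replicate (i - r) (f (s p)) ++ χ u) (level s (p + 1)) (level s (q + r)) := by
    intro r
    induction r with
    | zero =>
      intro _
      have h1 := hχ.comp (maps_level s p)
      have e : (fun u => (psi (s p) u).flatMap χ) = fun u => if u = s p then χ u else
          List.replicate (i - 0) (f (s p)) ++ χ u := by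
        funext u
        by_cases hu : u = s p
        · simp [hu]
        · simp [psi_of_ne hu, hu, hz]
      rwa [e] at h1
    | succ r ih =>
      intro hr
      have hm := ih (by omega)
      obtain ⟨k, hk⟩ : ∃ k, i - r = k + 1 := ⟨i - r - 1, by omega⟩
      obtain ⟨l, hl⟩ : ∃ l, i = l + 1 := ⟨i - 1, by omega⟩
      have hh : ∀ u, ∃ t, (if u = s p then χ u else
          List.replicate (i - r) (f (s p)) ++ χ u) = f (s p) :: t := by
        intro u
        by_cases hu : u = s p
        · rw [if_pos hu, hu, hz, hl, List.replicate_succ]; exact ⟨_, rfl⟩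
        · rw [if_neg hu, hk, List.replicate_succ]; exact ⟨_, rfl⟩
      have hxr : f (s p) = s (q + r) := by
        obtain ⟨t, ht⟩ := hh (level s (p + 1) 0)
        have := hm.head_eq ht
        rw [← this, level_zero_eq]
      obtain ⟨χ', h1, h2⟩ := (isSeparating_psi (s (q + r))).factor hm (maps_level s (q + r))
        (fun u => by
          obtain ⟨t, ht⟩ := hh u
          rw [ht, hxr]; rfl) (h.exists_level_eq (p + 1))
      have e : χ' = fun u => if u = s p then χ u else
          List.replicate (i - (r + 1)) (f (s p)) ++ χ u := by
        funext u
        apply (isSeparating_psi (s (q + r))).flatMap_injective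
        simp only [← h1]
        by_cases hu : u = s p
        · rw [if_pos hu, if_pos hu, hu, hz, flatMap_replicate, ← hxr, psi_self]
          simp
        · rw [if_neg hu, if_neg hu, hne u hu, List.flatMap_append, flatMap_replicate, ← hxr,
            psi_self, hk, show i - (r + 1) = k by omega, List.replicate_succ']
          have : f u ≠ f (s p) := fun e => hu (hf e)
          simp [psi_of_ne this]
      rw [e] at h2
      exact h2
  have := key i le_rfl
  simpa using this

/-- `maps_power` moves up the tower with the same `χ` until the directive letter is not `z`; there
f(z) is not separating and has no square. -/
theorem exponents_eq_one (h : IsFixedPointFor a b c n s) {i : ℕ} (hi : 1 ≤ i) {z : A}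
    (hz : χ z = List.replicate i (f z)) (hne : ∀ u ≠ z, χ u = [f u])
    (hf : Function.Injective f) (d : ℕ) :
    ∀ p q, s (p + d) ≠ z → Maps χ (level s p) (level s q) → i = 1 := by
  have key : ∀ p q, Maps χ (level s p) (level s q) → s p ≠ z → i = 1 := by
    intro p q hχ hp
    apply h.exponent_eq_one hχ hi hz
    have := hχ.head_eq (e := f (s p)) (t := []) (by rw [level_zero_eq, hne _ hp])
    rw [level_zero_eq] at this
    rw [this]
    exact fun e => hp (hf e).symm
  induction d with
  | zero => intro p q hd hχ; exact key p q hχ hd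
  | succ d ih =>
    intro p q hd hχ
    by_cases hp : s p = z
    · subst hp
      exact ih (p + 1) (q + i) (by rwa [Nat.add_right_comm, Nat.add_assoc])
        (h.maps_power hi hχ hz hne hf)
    · exact key p q hχ hp

theorem exists_letter_map (h : IsFixedPointFor a b c n s)
    (hχ : IntertwinesWith τ s F p q χ [] f Set.univ) :
    Function.Injective f ∧ ∀ u, χ u = [f u] := by
  have hpure : ∀ u, ∃ i, 1 ≤ i ∧ χ u = List.replicate i (f u) := fun u => by
    simpa using hχ.pure u (Set.mem_univ u)
  have hne : ∀ u, χ u ≠ [] := fun u hu => by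
    obtain ⟨i, hi, he⟩ := hpure u
    rw [hu] at he
    have := congrArg List.length he
    simp at this; omega
  have hsurj : Function.Surjective f := by
    intro y
    obtain ⟨k, rfl⟩ := h.exists_level_eq q y
    obtain ⟨l, h1, h2⟩ := exists_blockPos_le hne (level s p) k
    obtain ⟨j, rfl⟩ := Nat.exists_eq_add_of_le h1
    rw [blockPos_succ] at h2
    have h3 := hχ.maps.getElem_block l j (by omega)
    obtain ⟨i, -, he⟩ := hpure (level s p l)
    refine ⟨level s p l, ?_⟩
    rw [h3]
    simp [he]
  have := h.finite
  have hinj : Function.Injective f := Finite.injective_iff_surjective.2 hsurj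
  refine ⟨hinj, ?_⟩
  have hx : f (s p) = s q := by
    obtain ⟨t, ht⟩ := hχ.pre (s p)
    have := hχ.maps.head_eq (e := f (s p)) (t := t) (by rw [level_zero_eq, ← ht]; simp)
    rw [← this, level_zero_eq]
  have hother : ∀ u ≠ s p, χ u = [f u] := by
    intro u hu
    obtain ⟨i, hi, he⟩ := hpure u
    have := h.exponent_eq_one hχ.maps hi he (by rw [← hx]; exact fun e => hu (hinj e))
    rw [he, this]; rfl
  intro u
  by_cases hu : u = s p
  · subst hu
    obtain ⟨i, hi, he⟩ := hpure (s p)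
    obtain ⟨y, hy⟩ : ∃ y, y ≠ s p := by
      by_cases ha : a = s p
      · exact ⟨b, fun hb => h.hab (ha.trans hb.symm)⟩
      · exact ⟨a, ha⟩
    obtain ⟨k, hk, hky⟩ := h.exists_apply_eq p y
    obtain ⟨d, rfl⟩ := Nat.exists_eq_add_of_le hk
    have := h.exponents_eq_one hi he hother hinj d p q (by rwa [hky]) hχ.maps
    rw [he, this]; rfl
  · exact hother u hu

theorem letter_map_directive (h : IsFixedPointFor a b c n s) (hf : Function.Injective f)
    (hχ : Maps (fun u => [f u]) (level s p) (level s q)) (r : ℕ) : f (s (p + r)) = s (q + r) := by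
  have key : ∀ r, Maps (fun u => [f u]) (level s (p + r)) (level s (q + r)) := by
    intro r
    induction r with
    | zero => exact hχ
    | succ r ih =>
      have := h.maps_power (p := p + r) (q := q + r) (i := 1) (f := f) le_rfl ih (by simp)
        (fun u _ => rfl) hf
      exact this
  have := (key r).head_eq rfl
  rw [level_zero_eq, level_zero_eq] at this
  exact this.symm

/-- Iterating the shift as often as the order of `e` gives a period of `s` from `m` on, hence
arbitrarily high powers. -/
theorem not_shift_perm (h : IsFixedPointFor a b c n s) (e : Equiv.Perm A) {m d : ℕ} (hd : 1 ≤ d)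
    (he : ∀ r, s (m + d + r) = e (s (m + r))) : False := by
  have := h.finite
  have hpow : ∀ k r, s (m + k * d + r) = (e ^ k) (s (m + r)) := by
    intro k
    induction k with
    | zero => simp
    | succ k ih =>
      intro r
      rw [pow_succ', Equiv.Perm.mul_apply, ← ih r, Nat.add_assoc m (k * d) r, ← he]
      congr 1; ring
  have hN : 0 < orderOf e := orderOf_pos e
  refine h.not_hasPeriodOn (p := orderOf e * d) (i := m) (Nat.mul_pos hN hd) ?_
  intro j _
  have := hpow (orderOf e) j
  rw [pow_orderOf_eq_one, Equiv.Perm.one_apply] at this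
  rw [← this]; congr 1; omega

theorem eq_of_letter_map (h : IsFixedPointFor a b c n s) (hf : Function.Injective f)
    (hχ : Maps (fun u => [f u]) (level s p) (level s q)) : p = q ∧ f = id := by
  have := h.finite
  have hdir := h.letter_map_directive hf hχ
  obtain ⟨e, he⟩ : ∃ e : Equiv.Perm A, ∀ u, e u = f u :=
    ⟨Equiv.ofBijective f (Finite.injective_iff_bijective.1 hf), fun u => rfl⟩
  have hpq : p = q := by
    rcases lt_trichotomy p q with hlt | heq | hlt
    · obtain ⟨d, rfl⟩ := Nat.exists_eq_add_of_le hlt.le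
      exact (h.not_shift_perm e (m := p) (d := d) (by omega)
        (fun r => by rw [he, hdir])).elim
    · exact heq
    · obtain ⟨d, rfl⟩ := Nat.exists_eq_add_of_le hlt.le
      exact (h.not_shift_perm e.symm (m := q) (d := d) (by omega)
        (fun r => by rw [← hdir, ← he, Equiv.symm_apply_apply])).elim
  subst hpq
  refine ⟨rfl, ?_⟩
  funext u
  obtain ⟨i, hi, rfl⟩ := h.exists_apply_eq p u
  obtain ⟨r, rfl⟩ := Nat.exists_eq_add_of_le hi
  exact hdir r

theorem flatMap_levelSubst_eq_self (p : ℕ)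
    (hF : ∀ u, (levelSubst τ s p u).flatMap F = levelSubst τ s p u) :
    ∀ u, (mu τ u).flatMap F = mu τ u := by
  induction p with
  | zero => exact hF
  | succ p ih =>
    apply ih
    have hx : (levelSubst τ s p (s p)).flatMap F = levelSubst τ s p (s p) := by
      have := hF (s p)
      simpa [levelSubst] using this
    intro u
    by_cases hu : u = s p
    · rw [hu, hx]
    · have := hF u
      simp only [levelSubst, psi_of_ne hu, List.flatMap_cons, List.flatMap_nil, List.append_nil,
        List.flatMap_append, hx, List.append_cancel_left_eq] at this
      exact this

theorem eq_singleton_of_mu (h : IsFixedPointFor a b c n s)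
    (hF : ∀ u, (mu (Equiv.swap b c) u).flatMap F = mu (Equiv.swap b c) u) (u : A) : F u = [u] := by
  have ha : F a = [a] := by
    have := hF a
    simpa [mu, Equiv.swap_apply_of_ne_of_ne h.hab h.hac] using this
  have hb : F b ++ F c = [b, c] := by
    have := hF b
    simpa [mu, h.hbc.symm] using this
  have hc : F c ++ F b = [c, b] := by
    have := hF c
    simpa [mu, h.hbc] using this
  have hbc := h.hbc
  have hb1 : F b = [b] ∧ F c = [c] := by
    rcases hFb : F b with _ | ⟨x, _ | ⟨y, l⟩⟩
    · rw [hFb] at hb hc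
      simp only [List.nil_append, List.append_nil] at hb hc
      rw [hb] at hc
      simp at hc
      exact absurd hc.1 hbc
    · rw [hFb] at hb
      simp only [List.cons_append, List.nil_append, List.cons.injEq] at hb
      rw [hb.1, hb.2]
      exact ⟨rfl, rfl⟩
    · rw [hFb] at hb hc
      simp only [List.cons_append, List.cons.injEq, List.append_eq_nil_iff] at hb
      rw [hb.1, hb.2.1, hb.2.2.1, hb.2.2.2] at hc
      simp at hc
      exact absurd hc.1 hbc
  rcases h.cover u with rfl | rfl | rfl
  · exact ha
  · exact hb1.1
  · exact hb1.2

/-- `F` may erase letters, but all blocks of level n + 1 start with a^n b c, which contains every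
letter and is a prefix of `s`. So their images are nonempty, start with `a`, and can be
desubstituted by mu ψ_a. -/
theorem exists_intertwines (h : IsFixedPointFor a b c n s) (hF : Maps F s s)
    (hlong : ∃ u, F u ≠ []) :
    ∃ χ, Intertwines (Equiv.swap b c) s F (n + 1) 1 χ ∧ ∀ u, χ u ≠ [] := by
  set σ := levelSubst (Equiv.swap b c) s (n + 1) with hσ
  have hm : Maps σ (level s (n + 1)) s := h.maps_subst (n + 1)
  set K := List.replicate n a ++ [b, c] with hK
  have hpre : ∀ u, K <+: σ u := h.prefix_subst
  obtain ⟨e, t, ht⟩ : ∃ e t, K.flatMap F = e :: t := by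
    apply List.exists_cons_of_ne_nil
    obtain ⟨u, hu⟩ := hlong
    intro hnil
    rw [List.flatMap_eq_nil_iff] at hnil
    have := h.one_le
    apply hu (hnil u ?_)
    rcases h.cover u with rfl | rfl | rfl <;> (simp [hK]; try omega)
  have hKF : IsPrefixOf (K.flatMap F) s := by
    have h1 : IsPrefixOf K s := by
      have := hm 1
      rw [show prefixOf (level s (n + 1)) 1 = [level s (n + 1) 0] by simp [prefixOf, factorAt]]
        at this
      simp only [List.flatMap_cons, List.flatMap_nil, List.append_nil] at this
      exact this.of_prefix (hpre _)
    have := hF K.length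
    rwa [h1] at this
  have he : e = a := by
    have := isPrefixOf_iff.1 hKF 0 (by rw [ht]; simp)
    rw [h.apply_zero] at this
    simpa [ht] using this
  have hcons : ∀ u, ∃ t', (σ u).flatMap F = a :: t' := by
    intro u
    obtain ⟨r, hr⟩ := hpre u
    rw [← hr, List.flatMap_append, ht, he]
    exact ⟨_, rfl⟩
  obtain ⟨χ, h1, h2⟩ := h.isSeparating_subst_one.factor (hF.comp hm) (h.maps_subst 1)
    (fun u => by obtain ⟨t', ht'⟩ := hcons u; rw [ht']; rfl) (h.exists_level_eq (n + 1))
  refine ⟨χ, ⟨h1, h2⟩, fun u hu => ?_⟩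
  obtain ⟨t', ht'⟩ := hcons u
  have := h1 u
  rw [hu, ht'] at this
  simp at this

theorem eq_singleton_of_maps (h : IsFixedPointFor a b c n s) (hF : Maps F s s)
    (hlong : ∃ u, F u ≠ []) (u : A) : F u = [u] := by
  obtain ⟨χ, h1, h2⟩ := h.exists_intertwines hF hlong
  obtain ⟨q₁, χ₁, f, h3⟩ := h.exists_intertwinesWith h1 h2
  obtain ⟨p, q, χ', h4⟩ := h.exists_pure h3
  obtain ⟨hf, hχ'⟩ := h.exists_letter_map h4
  obtain rfl : χ' = fun u => [f u] := funext hχ'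
  obtain ⟨rfl, rfl⟩ := h.eq_of_letter_map hf h4.maps
  apply h.eq_singleton_of_mu
  apply flatMap_levelSubst_eq_self p
  intro u
  rw [h4.comm]
  simp

theorem not_isFixedByMorphism (h : IsFixedPointFor a b c n s)
    {φ : FreeMonoid A →* FreeMonoid A} (hφ : φ ≠ MonoidHom.id (FreeMonoid A)) :
    ¬ IsFixedByMorphism φ s := by
  rintro ⟨h1, h2⟩
  set F : A → List A := fun u => (φ (FreeMonoid.of u)).toList with hFdef
  have hlist : ∀ l : List A, (φ (FreeMonoid.ofList l)).toList = l.flatMap F := by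
    intro l
    induction l with
    | nil => simp
    | cons x l ih =>
      rw [FreeMonoid.ofList_cons, map_mul, FreeMonoid.toList_mul, ih]
      rfl
  have hF : Maps F s s := fun k => by
    have := h1 k
    rwa [imagePrefix, hlist] at this
  apply hφ
  apply FreeMonoid.hom_eq
  intro u
  apply FreeMonoid.toList.injective
  refine h.eq_singleton_of_maps hF ?_ u
  by_contra hall
  push Not at hall
  obtain ⟨k, hk⟩ := h2 1
  rw [imagePrefix, hlist] at hk
  have : (prefixOf s k).flatMap F = [] := by
    rw [List.flatMap_eq_nil_iff]; exact fun x _ => hall x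
  rw [this] at hk
  simp at hk

end IsFixedPointFor

end FixedByMorphism

/-! ### Letter frequencies, and not being episturmian -/

section Frequency

variable {A : Type*} [DecidableEq A] {a b c : A} {n : ℕ} {s : ℕ → A}

/-- A sequence of weights of letters that follows the substitutions `psi (s m)`. -/
def IsAdditiveAlong (s : ℕ → A) (d : ℕ → A → ℝ) : Prop :=
  ∀ m u, d (m + 1) u = if u = s m then d m u else d m (s m) + d m u

namespace IsAdditiveAlong

variable {d : ℕ → A → ℝ}

theorem mono (hd : IsAdditiveAlong s d) {m : ℕ} (h0 : ∀ u, 0 ≤ d m u) (k : ℕ) (u : A) :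
    d m u ≤ d (m + k) u := by
  induction k generalizing u with
  | zero => exact le_rfl
  | succ k ih =>
    rw [← Nat.add_assoc, hd]
    split
    · exact ih u
    · have := ih u
      have := ih (s (m + k))
      have := h0 (s (m + k))
      linarith

theorem le_of_window (hd : IsAdditiveAlong s d) {m G : ℕ} (h0 : ∀ u, 0 ≤ d m u) {y : A}
    (hy : ∃ i, m ≤ i ∧ i < m + G ∧ s i = y) (u : A) : d m y ≤ d (m + G) u := by
  obtain ⟨i, h1, h2, rfl⟩ := hy
  obtain ⟨j, rfl⟩ := Nat.exists_eq_add_of_le h1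
  obtain ⟨k, rfl⟩ := Nat.exists_eq_add_of_le (show j + 1 ≤ G by omega)
  have h3 : ∀ v, 0 ≤ d (m + j) v := fun v => (h0 v).trans (hd.mono h0 j v)
  have h4 : d (m + j) (s (m + j)) ≤ d (m + j + 1) u := by
    rw [hd]
    split
    · rename_i hu; rw [hu]
    · have := h3 u; linarith
  have h5 := hd.mono (m := m + j + 1) (fun v => (h3 v).trans (hd.mono h3 1 v)) k u
  have h6 := hd.mono h0 j (s (m + j))
  rw [show m + (j + 1 + k) = m + j + 1 + k by omega]
  linarith

theorem le_two_pow (hd : IsAdditiveAlong s d) {m : ℕ} {B : ℝ} (hB : 0 ≤ B)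
    (h : ∀ u, d m u ≤ B) (k : ℕ) (u : A) : d (m + k) u ≤ 2 ^ k * B := by
  induction k generalizing u with
  | zero => simpa using h u
  | succ k ih =>
    rw [← Nat.add_assoc, hd, pow_succ]
    have h1 := ih u
    have h2 := ih (s (m + k))
    have h3 : 0 ≤ (2 : ℝ) ^ k * B := by positivity
    split <;> linarith

theorem sub {d' : ℕ → A → ℝ} (hd : IsAdditiveAlong s d) (hd' : IsAdditiveAlong s d') (x y : ℝ) :
    IsAdditiveAlong s (fun m u => x * d m u - y * d' m u) := by
  intro m u
  simp only [hd m u, hd' m u]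
  split <;> ring

end IsAdditiveAlong

theorem isAdditiveAlong_length (τ : Equiv.Perm A) (s : ℕ → A) :
    IsAdditiveAlong s (fun m u => ((levelSubst τ s m u).length : ℝ)) := by
  intro m u
  by_cases hu : u = s m
  · simp [levelSubst, hu]
  · simp [levelSubst, psi_of_ne hu, hu]

theorem isAdditiveAlong_count (τ : Equiv.Perm A) (s : ℕ → A) (y : A) :
    IsAdditiveAlong s (fun m u => ((levelSubst τ s m u).count y : ℝ)) := by
  intro m u
  by_cases hu : u = s m
  · simp [levelSubst, hu]
  · simp [levelSubst, psi_of_ne hu, hu]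

/-- The quotients `e m u / d m u` lie between `lo` and `hi`. -/
def RatioBetween (d e : ℕ → A → ℝ) (lo hi : ℝ) (m : ℕ) : Prop :=
  ∀ u, lo * d m u ≤ e m u ∧ e m u ≤ hi * d m u

variable {d e : ℕ → A → ℝ}

theorem RatioBetween.add (hd : IsAdditiveAlong s d) (he : IsAdditiveAlong s e) {lo hi : ℝ} {m : ℕ}
    (h : RatioBetween d e lo hi m) (k : ℕ) : RatioBetween d e lo hi (m + k) := by
  intro u
  have h1 := (he.sub hd 1 lo).mono (m := m) (fun v => by have := (h v).1; linarith) k u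
  have h2 := (hd.sub he hi 1).mono (m := m) (fun v => by have := (h v).2; linarith) k u
  have h3 := h u
  constructor <;> linarith

/-- If no ratio is in the lower half of the interval, the lower end moves to the midpoint. Otherwise
some `x` is in the lower half; within `G` further steps every letter absorbs `x`. Values at most
double per step and every letter absorbs the largest value within the first `G` steps, so the share
of `x` is at least 4^{-G}, which lowers the upper end. -/
theorem RatioBetween.contract [Finite A] (hd : IsAdditiveAlong s d) (he : IsAdditiveAlong s e)
    (hpos : ∀ m u, 0 < d m u) {G : ℕ} (hG : ∀ m y, ∃ i, m ≤ i ∧ i < m + G ∧ s i = y) {lo hi : ℝ}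
    {m : ℕ} (hle : lo ≤ hi) (h : RatioBetween d e lo hi (m + G)) :
    ∃ lo' hi', lo' ≤ hi' ∧ hi' - lo' ≤ (1 - 1 / (2 * 4 ^ G)) * (hi - lo) ∧
      RatioBetween d e lo' hi' (m + G + G) := by
  have h4 : (1 : ℝ) ≤ 4 ^ G := one_le_pow₀ (by norm_num)
  have hκ : 1 / (2 * 4 ^ G) ≤ (1 / 2 : ℝ) := by
    rw [div_le_div_iff₀ (by positivity) (by norm_num)]; linarith
  by_cases hx : ∃ x, e (m + G) x ≤ (lo + hi) / 2 * d (m + G) x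
  · obtain ⟨x, hx⟩ := hx
    have : Nonempty A := ⟨x⟩
    have hlen : ∀ u, d (m + G + G) u ≤ 4 ^ G * d (m + G) x := by
      obtain ⟨y, hy⟩ := Finite.exists_max (d m)
      have e1 : ∀ u, d (m + G) u ≤ 2 ^ G * d m y := hd.le_two_pow (hpos m y).le hy G
      have e2 : d m y ≤ d (m + G) x := hd.le_of_window (fun u => (hpos m u).le) (hG m y) x
      intro u
      have e3 := hd.le_two_pow (m := m + G) (B := 2 ^ G * d m y)
        (mul_nonneg (by positivity) (hpos m y).le) e1 G u
      calc d (m + G + G) u ≤ 2 ^ G * (2 ^ G * d m y) := e3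
        _ = 4 ^ G * d m y := by rw [← mul_assoc, ← mul_pow]; norm_num
        _ ≤ 4 ^ G * d (m + G) x := by gcongr
    refine ⟨lo, hi - 1 / (2 * 4 ^ G) * (hi - lo), ?_, by linarith, fun u => ?_⟩
    · nlinarith
    · refine ⟨(h.add hd he G u).1, ?_⟩
      have e1 := (hd.sub he hi 1).le_of_window (m := m + G)
        (fun v => by have := (h v).2; linarith) (hG (m + G) x) u
      have e2 : 1 / (2 * 4 ^ G) * (hi - lo) * d (m + G + G) u ≤
          (hi - lo) / 2 * d (m + G) x := by
        calc 1 / (2 * 4 ^ G) * (hi - lo) * d (m + G + G) u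
            ≤ 1 / (2 * 4 ^ G) * (hi - lo) * (4 ^ G * d (m + G) x) := by
              apply mul_le_mul_of_nonneg_left (hlen u)
              exact mul_nonneg (by positivity) (by linarith)
          _ = (hi - lo) / 2 * d (m + G) x := by field_simp
      linarith
  · push Not at hx
    have hmid : RatioBetween d e ((lo + hi) / 2) hi (m + G) := fun u => ⟨(hx u).le, (h u).2⟩
    refine ⟨(lo + hi) / 2, hi, by linarith, ?_, hmid.add hd he G⟩
    nlinarith

theorem exists_limit_ratio [Finite A] [Nonempty A] (hd : IsAdditiveAlong s d)
    (he : IsAdditiveAlong s e) (hpos : ∀ m u, 0 < d m u) (he0 : ∀ m u, 0 ≤ e m u)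
    (hed : ∀ m u, e m u ≤ d m u) {G : ℕ} (hG : ∀ m y, ∃ i, m ≤ i ∧ i < m + G ∧ s i = y) :
    ∃ ρ : ℝ, ∀ ε > 0, ∃ m, ∀ u, |e m u - ρ * d m u| ≤ ε * d m u := by
  set κ : ℝ := 1 - 1 / (2 * 4 ^ G) with hκ
  have h4 : (1 : ℝ) ≤ 4 ^ G := one_le_pow₀ (by norm_num)
  have hκ1 : κ < 1 := by
    have : (0 : ℝ) < 1 / (2 * 4 ^ G) := by positivity
    linarith
  have hκ0 : 0 ≤ κ := by
    have : 1 / (2 * 4 ^ G) ≤ (1 : ℝ) := by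
      rw [div_le_one (by positivity)]; linarith
    linarith
  have key : ∀ k : ℕ, ∃ m lo hi, lo ≤ hi ∧ hi - lo ≤ κ ^ k ∧ RatioBetween d e lo hi (m + G) := by
    intro k
    induction k with
    | zero =>
      refine ⟨0, 0, 1, by norm_num, by norm_num, fun u => ⟨?_, ?_⟩⟩
      · rw [zero_mul]; exact he0 _ u
      · rw [one_mul]; exact hed _ u
    | succ k ih =>
      obtain ⟨m, lo, hi, h1, h2, h3⟩ := ih
      obtain ⟨lo', hi', h1', h2', h3'⟩ := h3.contract hd he hpos hG h1
      refine ⟨m + G, lo', hi', h1', h2'.trans ?_, h3'⟩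
      rw [pow_succ']
      exact mul_le_mul_of_nonneg_left h2 hκ0
  have hcmp : ∀ m lo hi m' lo' hi', RatioBetween d e lo hi m → RatioBetween d e lo' hi' m' →
      lo ≤ hi' := by
    intro m lo hi m' lo' hi' h1 h2
    have e1 := h1.add hd he m' (Classical.arbitrary A)
    have e2 := h2.add hd he m (Classical.arbitrary A)
    rw [Nat.add_comm m' m] at e2
    exact le_of_mul_le_mul_right (e1.1.trans e2.2) (hpos _ _)
  -- Any lower bound, at any level, lies below any upper bound, so the supremum of the lower bounds
  -- lies in all the intervals.
  set S : Set ℝ := {lo | ∃ hi m, RatioBetween d e lo hi m} with hS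
  have hbetween : ∀ m lo hi, RatioBetween d e lo hi m → lo ≤ sSup S ∧ sSup S ≤ hi := by
    intro m lo hi h
    have hub : ∀ x ∈ S, x ≤ hi := fun x ⟨hi', m', h'⟩ => hcmp _ _ _ _ _ _ h' h
    exact ⟨le_csSup ⟨hi, hub⟩ ⟨hi, m, h⟩, csSup_le ⟨lo, hi, m, h⟩ hub⟩
  refine ⟨sSup S, fun ε hε => ?_⟩
  obtain ⟨k, hk⟩ := exists_pow_lt_of_lt_one hε hκ1
  obtain ⟨m, lo, hi, -, h2, h3⟩ := key k
  obtain ⟨h5, h6⟩ := hbetween _ _ _ h3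
  refine ⟨m + G, fun u => ?_⟩
  have h7 := h3 u
  have h8 := hpos (m + G) u
  rw [abs_le]
  constructor <;> nlinarith

/-- A prefix is a product of blocks, on which the deviations add up, and a piece of a block of
bounded length, which is negligible in the limit. -/
theorem hasFrequency_of_blocks {y : A} {ρ : ℝ}
    (h : ∀ ε > 0, ∃ (σ : A → List A) (w : ℕ → A), Maps σ w s ∧ (∀ u, σ u ≠ []) ∧
      (∃ C, ∀ u, (σ u).length ≤ C) ∧
      ∀ u, |((σ u).count y : ℝ) - ρ * (σ u).length| ≤ ε * (σ u).length) :
    HasFrequency s y ρ := by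
  rw [HasFrequency, Metric.tendsto_atTop]
  intro ε hε
  obtain ⟨σ, w, hm, hne, ⟨C, hC⟩, hσ⟩ := h (ε / 2) (by linarith)
  have hlist : ∀ l : List A, |((l.flatMap σ).count y : ℝ) - ρ * (l.flatMap σ).length| ≤
      ε / 2 * (l.flatMap σ).length := by
    intro l
    induction l with
    | nil => simp
    | cons u l ih =>
      rw [List.flatMap_cons, List.count_append, List.length_append]
      push_cast
      calc _ = |(((σ u).count y : ℝ) - ρ * (σ u).length) +
            (((l.flatMap σ).count y : ℝ) - ρ * (l.flatMap σ).length)| := by congr 1; ring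
        _ ≤ _ := abs_add_le _ _
        _ ≤ _ := by have := hσ u; linarith
  obtain ⟨N, hN⟩ := exists_nat_gt ((1 + |ρ|) * C * 2 / ε)
  refine ⟨N + 1, fun k hk => ?_⟩
  have hk0 : (0 : ℝ) < k := by exact_mod_cast (show 0 < k by omega)
  obtain ⟨K, h1, h2⟩ := exists_blockPos_le hne w k
  obtain ⟨r, hr⟩ := Nat.exists_eq_add_of_le h1
  have hrC : r ≤ C := by
    have := hC (w K)
    rw [blockPos_succ] at h2
    omega
  have hpre : prefixOf s (blockPos σ w K) = (prefixOf w K).flatMap σ := hm K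
  have hcount : (prefixOf s k).count y = ((prefixOf w K).flatMap σ).count y +
      (factorAt s (blockPos σ w K) r).count y := by
    rw [hr, prefixOf_add, List.count_append, hpre]
  have h3 := hlist (prefixOf w K)
  rw [show ((prefixOf w K).flatMap σ).length = blockPos σ w K from rfl] at h3
  have h4 : (factorAt s (blockPos σ w K) r).count y ≤ r := by
    simpa using List.count_le_length (a := y) (l := factorAt s (blockPos σ w K) r)
  generalize ((prefixOf w K).flatMap σ).count y = X at *
  generalize (factorAt s (blockPos σ w K) r).count y = Y at *
  have hkr : (k : ℝ) = blockPos σ w K + r := by exact_mod_cast hr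
  have hY : (Y : ℝ) ≤ C := by exact_mod_cast h4.trans hrC
  have hr' : (r : ℝ) ≤ C := by exact_mod_cast hrC
  have h5 : |(Y : ℝ) - ρ * r| ≤ (1 + |ρ|) * C := by
    calc |(Y : ℝ) - ρ * r| ≤ |(Y : ℝ)| + |ρ * r| := abs_sub _ _
      _ = Y + |ρ| * r := by rw [abs_mul, Nat.abs_cast, Nat.abs_cast]
      _ ≤ C + |ρ| * C := by gcongr
      _ = (1 + |ρ|) * C := by ring
  have h6 : (1 + |ρ|) * C * 2 < ε * k := by
    rw [div_lt_iff₀ hε] at hN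
    have : (N : ℝ) ≤ k := by exact_mod_cast (show N ≤ k by omega)
    nlinarith
  have h7 : (0 : ℝ) ≤ r := Nat.cast_nonneg r
  rw [Real.dist_eq, hcount, show ((X + Y : ℕ) : ℝ) / k - ρ =
    ((X - ρ * blockPos σ w K) + (Y - ρ * r)) / k by
      rw [eq_div_iff hk0.ne', sub_mul, div_mul_cancel₀ _ hk0.ne', hkr]; push_cast; ring,
    abs_div, Nat.abs_cast, div_lt_iff₀ hk0]
  calc _ ≤ |(X : ℝ) - ρ * blockPos σ w K| + |(Y : ℝ) - ρ * r| := abs_add_le _ _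
    _ < ε * k := by
      have : ε / 2 * (blockPos σ w K : ℝ) ≤ ε / 2 * k := by
        rw [hkr]; nlinarith
      linarith

namespace IsFixedPointFor

theorem count_subst (h : IsFixedPointFor a b c n s) (m : ℕ) (u : A) :
    (levelSubst (Equiv.swap b c) s m u).count b = (levelSubst (Equiv.swap b c) s m u).count c := by
  induction m generalizing u with
  | zero =>
    rcases h.cover u with rfl | rfl | rfl
    · rw [h.subst_a (Nat.zero_le n)]
      simp [h.hab, h.hac]
    · rw [h.subst_b (Nat.zero_le n)]
      simp [h.hbc, h.hbc.symm]
    · rw [h.subst_c (Nat.zero_le n)]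
      simp [h.hbc, h.hbc.symm]
  | succ m ih =>
    by_cases hu : u = s m
    · simp [levelSubst, hu, ih]
    · simp [levelSubst, psi_of_ne hu, ih]

theorem exists_frequency (h : IsFixedPointFor a b c n s) :
    ∃ ρ : ℝ, HasFrequency s b ρ ∧ HasFrequency s c ρ := by
  have := h.finite
  have : Nonempty A := ⟨a⟩
  obtain ⟨G, hG⟩ := h.exists_gap
  obtain ⟨ρ, hρ⟩ := exists_limit_ratio (isAdditiveAlong_length (Equiv.swap b c) s)
    (isAdditiveAlong_count (Equiv.swap b c) s b)
    (fun m u => by exact_mod_cast List.length_pos_iff.2 (levelSubst_ne_nil _ s m u))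
    (fun m u => Nat.cast_nonneg _) (fun m u => by exact_mod_cast List.count_le_length) hG
  have key : ∀ y, (∀ m u, (levelSubst (Equiv.swap b c) s m u).count y =
      (levelSubst (Equiv.swap b c) s m u).count b) → HasFrequency s y ρ := by
    intro y hy
    apply hasFrequency_of_blocks
    intro ε hε
    obtain ⟨m, hm⟩ := hρ ε hε
    obtain ⟨v, hv⟩ := Finite.exists_max fun u => (levelSubst (Equiv.swap b c) s m u).length
    exact ⟨_, _, h.maps_subst m, levelSubst_ne_nil _ s m, ⟨_, hv⟩, fun u => by
      rw [hy]; exact hm u⟩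
  exact ⟨ρ, key b (fun _ _ => rfl), key c (fun m u => (h.count_subst m u).symm)⟩

/-- The prefix of `s` continues as a^n b c a, so the first directive letter would have to occur in
each of ab, bc and ca. -/
theorem not_isEpisturmian (h : IsFixedPointFor a b c n s) : ¬ IsEpisturmian s := by
  rintro ⟨t, ⟨Δ, rfl⟩, hfac⟩
  obtain ⟨k, rfl⟩ := Nat.exists_eq_add_of_le' h.one_le
  have hk : s k = a := h.apply_lt (Nat.lt_succ_self k)
  have hk1 : s (k + 1) = b := h.apply_eq
  have hk2 : s (k + 2) = c := by
    obtain ⟨-, ⟨-, e⟩ | ⟨e, -⟩⟩ := h.neighbours (i := k + 1) (by rw [hk1]; exact h.hab.symm)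
    · rw [e, hk1]; simp
    · rw [hk1, Equiv.swap_apply_left, Nat.add_sub_cancel, hk] at e
      exact absurd e h.hac
  have hk3 : s (k + 3) = a := by
    obtain ⟨-, ⟨e, -⟩ | ⟨-, e⟩⟩ := h.neighbours (i := k + 2) (by rw [hk2]; exact h.hac.symm)
    · rw [show k + 2 - 1 = k + 1 from rfl, hk1] at e
      exact absurd e.symm h.hab
    · exact e
  have hpair : ∀ i x y, s i = x → s (i + 1) = y → x = Δ 0 ∨ y = Δ 0 := by
    intro i x y hx hy
    obtain ⟨j, hj⟩ := (hfac [x, y]).1 ⟨i, by simp [factorAt, List.range_succ, hx, hy]⟩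
    simp only [factorAt, List.range_succ, List.range_zero, List.length_cons, List.length_nil,
      List.nil_append, List.cons_append, List.map_cons, List.map_nil, Nat.add_zero,
      List.cons.injEq, and_true, Nat.zero_add] at hj
    have hl : level Δ 0 = pseudoIPal 1 Δ := by simp [level]
    by_contra hne
    push Not at hne
    have := (level_separated Δ 0 j (by rw [hl, hj.1]; exact hne.1)).2.2
    rw [hl, hj.2] at this
    exact hne.2 this
  have h1 := hpair k a b hk hk1
  have h2 := hpair (k + 1) b c hk1 hk2
  have h3 := hpair (k + 2) c a hk2 hk3
  have hab := h.hab
  have hac := h.hac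
  have hbc := h.hbc
  grind

end IsFixedPointFor

end Frequency

theorem mainTheorem5 {A : Type*} [DecidableEq A] (a b c : A)
    (hab : a ≠ b) (hac : a ≠ c) (hbc : b ≠ c) (hA : ∀ x : A, x = a ∨ x = b ∨ x = c)
    (n : ℕ) (hn : 1 ≤ n) (s : ℕ → A)
    (hfix : pseudoIPal (Equiv.swap b c) s = s)
    (hpre : IsPrefixOf (List.replicate n a ++ [b]) s) :
    (¬ IsEpisturmian s ∧ IsPseudostandard s) ∧
    (∀ φ : FreeMonoid A →* FreeMonoid A, φ ≠ MonoidHom.id (FreeMonoid A) →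
      ¬ IsFixedByMorphism φ s) ∧
    (¬ ContainsPower s (n + 4) ∧ ContainsPower s (n + 3)) ∧
    (∃ ρ : ℝ, HasFrequency s b ρ ∧ HasFrequency s c ρ) := by
  have h : IsFixedPointFor a b c n s := ⟨hab, hac, hbc, hA, hn, hfix, hpre⟩
  exact ⟨⟨h.not_isEpisturmian, _, involutive_swap b c, s, hfix.symm⟩,
    fun φ hφ => h.not_isFixedByMorphism hφ, ⟨h.not_containsPower, h.containsPower⟩,
    h.exists_frequency⟩
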